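/- Consider $n$ users and $n$ servers, each server having capacity $\kappa\in\mathbb N$, and run the following discrete-time algorithm. Initially each user $u$ independently chooses a uniformly random set $S_u$ of $\sigma$ servers. At each time $t=0,1,2,\dots$ every user $u$ is connected to all servers in its current set $S_u$. A server $s$ with $L_s(t)$ connected users provides the bitrate $B(u,s,t)=\min\{1,\kappa/L_s(t)\}$ to each connected user $u$, and $B(u,s,t)=0$ if $u$ is not connected to $s$. Then simultaneously every user $u$ for which $B(u,s,t)=1$ for some $s\in S_u$ replaces $S_u$ by $\{s\}$ for one such $s$ (ties are broken arbitrarily), and every other user keeps $S_u$. Let $B(t)=\min_u\max_s B(u,s,t)$ be the minmax bitrate. (1) For every fixed integer $\sigma\ge 2$ there are constants $C,c>0$ and $n_0$, depending only on $\sigma$, such that for all $n\ge n_0$ and all integers $\kappa$ with $\kappa+1> e\,\sigma(\sigma-1)$ (that is, $\kappa>2e-1$ when $\sigma=2$), with probability at least $1-n^{-c}$, $$B(t)=1\quad\text{for all } t\ge T:=C\,\frac{\log\log n}{\log(\kappa+1)},$$ however ties are broken. (2) Let $\sigma=1$. There are absolute constants $C,c>0$ and $n_0$ such that for all $n\ge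 n_0$ and all integers $\kappa\ge 0$, with probability at least $1-n^{-c}$, $$B(t)\le C\,\frac{\kappa\log\log n}{\log n}\quad\text{for all } t\ge 0.$$ (3) Let $\sigma=1$. There is an absolute constant $c>0$ such that, whenever $\kappa=\kappa(n)=o(\log n/\log\log n)$ (for example, $\kappa$ constant), $B(t)$ tends to $0$ with high probability: for every $\varepsilon>0$ and all sufficiently large $n$, with probability at least $1-n^{-c}$, $B(t)\le\varepsilon$ for all $t\ge0$. -/

import Mathlib

open MeasureTheory ProbabilityTheory Filter Asymptotics

namespace Bitrate

/-- A state of the system with `n` users and `n` servers: the set `S u` of servers to which each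
user `u` is currently connected. -/
abbrev State (n : ℕ) : Type := Fin n → Finset (Fin n)

/-- The finite set of sets of servers carries the discrete σ-algebra. -/
instance instMeasurableSpaceServers (n : ℕ) : MeasurableSpace (Finset (Fin n)) := ⊤

instance instDiscreteServers (n : ℕ) : DiscreteMeasurableSpace (Finset (Fin n)) :=
  ⟨fun _ => trivial⟩

/-- The law of the initial candidate sets: the users choose independently, each of them a uniformly
random set of `σ` servers (a probability measure as soon as `σ ≤ n`). -/
noncomputable def initialLaw (n σ : ℕ) : Measure (State n) :=
  Measure.pi fun _ : Fin n => uniformOn {A : Finset (Fin n) | A.card = σ}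

/-- The number of users connected to server `s`. -/
def load {n : ℕ} (S : State n) (s : Fin n) : ℕ :=
  (Finset.univ.filter fun u => s ∈ S u).card

/-- The bitrate that server `s` provides to user `u`: the capacity `κ` is divided evenly among the
connected users, and no user draws more than the required unit. A user who is not connected to `s`
receives nothing from `s`. -/
noncomputable def bitrate {n : ℕ} (κ : ℕ) (S : State n) (u s : Fin n) : ℝ :=
  if s ∈ S u then min 1 ((κ : ℝ) / (load S s : ℝ)) else 0

/-- One synchronous time step of the algorithm: every user who receives the unit bitrate from some
of its servers keeps exactly one such server (an arbitrary one), and every other user keeps its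
set of servers. -/
def IsStep {n : ℕ} (κ : ℕ) (S S' : State n) : Prop :=
  ∀ u, (∃ s ∈ S u, bitrate κ S u s = 1 ∧ S' u = {s}) ∨
    ((∀ s ∈ S u, bitrate κ S u s ≠ 1) ∧ S' u = S u)

/-- `S t` is the state at time `t` in an execution of the algorithm with initial candidate
sets `ω`. Ties are broken arbitrarily, so that `ω` may have several executions. -/
def IsExecution {n : ℕ} (κ : ℕ) (ω : State n) (S : ℕ → State n) : Prop :=
  S 0 = ω ∧ ∀ t, IsStep κ (S t) (S (t + 1))

/-- The minmax bitrate: the best bitrate obtained by the worst user. -/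
noncomputable def minmaxBitrate {n : ℕ} (κ : ℕ) (S : State n) : ℝ :=
  ⨅ u, ⨆ s, bitrate κ S u s

end Bitrate

/-!
For two or more choices, the overloaded servers (those with more than `κ` users) evolve like the
parallel peeling process for the `(κ + 1)`-core of the random hypergraph whose vertices are the
servers and whose edges are the users: a server that is overloaded at time `t + 1` has `κ + 1`
users all of whose initial candidates were overloaded at time `t`. Following this backwards from a
server that is overloaded at time `h` yields a witness tree of depth about `h` in the initial
state, with servers as nodes and users as edges, and branching `κ` below the root.

The number of users that contain two given servers is close to a Poisson variable of mean
`λ / n`, where `λ = σ (σ - 1)`, so each node with `d` children contributes a factor `λ ^ d / d!` to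
the expected number of witness trees. As the hypergraph has cycles, the children of a node need not
be new; a user that cannot be used for this reason is a *defect*. Only `d = κ - 1` children per node
are asked for, which leaves room for one defect at each node, and a tree with two defects at the
same node is unlikely, since each of them costs a factor `1 / n` up to powers of `log n`
(`IsTree.exists_defect_or_grow`, `initialLaw_real_exists_isDefectiveTree_le`). The price for giving
up children is harmless: `λ ^ d / d! < 1` still holds as long as `d + 2 > e λ`, by Stirling's
formula (`pow_lt_factorial`). Hence a tree with `O(log n)` nodes is unlikely to exist, and a
`d`-ary tree reaches this number of nodes at depth `O(log log n / log d)`. For capacities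
above `log n` the tree is cut down to a single node with `⌈log n⌉` children.

For one choice nothing ever changes, and the claims amount to a lower bound for the maximal load
when `n` balls are thrown into `n` bins. The number of ways to have fewer than `k` balls in every
bin is at most `n! (∑ j < k, 1 / j!) ^ n` (`card_fibres_lt_le`), and
`∑ j < k, 1 / j! ≤ e - 1 / k!`, so the probability is at most
`e √n exp (-n / (e k!))`, which is tiny when `k! ≤ √n`; this holds for
`k = ⌊log n / (2 log log n)⌋`.
-/

namespace Bitrate

/-! ### Overloaded servers along an execution -/

lemma load_pos {n : ℕ} {S : State n} {u s : Fin n} (h : s ∈ S u) : 0 < load S s :=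
  Finset.card_pos.mpr ⟨u, by simpa using h⟩

lemma bitrate_eq_one_iff {n κ : ℕ} {S : State n} {u s : Fin n} (h : s ∈ S u) :
    bitrate κ S u s = 1 ↔ load S s ≤ κ := by
  have hpos : (0 : ℝ) < load S s := by exact_mod_cast load_pos h
  rw [bitrate, if_pos h, min_eq_left_iff, one_le_div hpos, Nat.cast_le]

lemma IsStep.subset {n κ : ℕ} {S S' : State n} (h : IsStep κ S S') (u : Fin n) : S' u ⊆ S u := by
  rcases h u with ⟨s, hs, -, h'⟩ | ⟨-, h'⟩
  · rw [h']; simpa using hs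
  · rw [h']

lemma IsStep.load_le {n κ : ℕ} {S S' : State n} (h : IsStep κ S S') (s : Fin n) :
    load S' s ≤ load S s := by
  refine Finset.card_le_card fun u hu => ?_
  simp only [Finset.mem_filter, Finset.mem_univ, true_and] at hu ⊢
  exact h.subset u hu

lemma IsExecution.load_antitone {n κ : ℕ} {ω : State n} {S : ℕ → State n}
    (h : IsExecution κ ω S) (s : Fin n) : Antitone fun t => load (S t) s :=
  antitone_nat_of_succ_le fun t => (h.2 t).load_le s

/-- A user has either kept its initial candidates or settled on a server that is not overloaded. -/
lemma IsExecution.eq_initial_or_settled {n κ : ℕ} {ω : State n} {S : ℕ → State n}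
    (h : IsExecution κ ω S) (t : ℕ) (u : Fin n) :
    S t u = ω u ∨ ∃ s, S t u = {s} ∧ load (S t) s ≤ κ := by
  induction t with
  | zero => left; rw [h.1]
  | succ t ih =>
    rcases h.2 t u with ⟨s, hs, hb, hS⟩ | ⟨hb, hS⟩
    · exact Or.inr ⟨s, hS, ((h.2 t).load_le s).trans ((bitrate_eq_one_iff hs).mp hb)⟩
    · rcases ih with ih | ⟨s, hs, hl⟩
      · exact Or.inl (hS.trans ih)
      · exact Or.inr ⟨s, hS.trans hs, ((h.2 t).load_le s).trans hl⟩

/-- Going back one time step: every user of a server that is still overloaded was unsatisfied one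
step earlier, so all its initial candidates were overloaded then. -/
lemma IsExecution.exists_users_of_overloaded {n κ : ℕ} {ω : State n} {S : ℕ → State n}
    (h : IsExecution κ ω S) {t : ℕ} {v : Fin n} (hv : κ < load (S (t + 1)) v) :
    ∃ U : Finset (Fin n), κ + 1 ≤ U.card ∧
      ∀ u ∈ U, v ∈ ω u ∧ ∀ s ∈ ω u, κ < load (S t) s := by
  refine ⟨Finset.univ.filter fun u => v ∈ S (t + 1) u, hv, fun u hu => ?_⟩
  have hu : v ∈ S (t + 1) u := by simpa using hu
  have hvt : κ < load (S t) v := hv.trans_le ((h.2 t).load_le v)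
  rcases h.2 t u with ⟨s, hs, hb, hS⟩ | ⟨hb, hS⟩
  · have hvs : v = s := by simpa [hS] using hu
    subst hvs
    exact absurd ((bitrate_eq_one_iff hs).mp hb) hvt.not_ge
  · rw [hS] at hu
    have hω : S t u = ω u := by
      rcases h.eq_initial_or_settled t u with h' | ⟨s, hs, hl⟩
      · exact h'
      · have hvs : v = s := by simpa [hs] using hu
        subst hvs
        exact absurd hl hvt.not_ge
    rw [← hω]
    exact ⟨hu, fun s hs => not_le.mp fun hle => hb s hs ((bitrate_eq_one_iff hs).mpr hle)⟩

lemma IsExecution.nonempty {n κ : ℕ} {ω : State n} {S : ℕ → State n}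
    (h : IsExecution κ ω S) (hω : ∀ u, (ω u).Nonempty) (t : ℕ) (u : Fin n) :
    (S t u).Nonempty := by
  rcases h.eq_initial_or_settled t u with h' | ⟨s, hs, -⟩
  · rw [h']; exact hω u
  · rw [hs]; exact Finset.singleton_nonempty s

lemma minmaxBitrate_eq_one {n κ : ℕ} [NeZero n] {S : State n} (hS : ∀ u, (S u).Nonempty)
    (hload : ∀ s, load S s ≤ κ) : minmaxBitrate κ S = 1 := by
  have key : ∀ u, ⨆ s, bitrate κ S u s = 1 := fun u => by
    obtain ⟨s, hs⟩ := hS u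
    have hle : ∀ s, bitrate κ S u s ≤ 1 := fun s => by
      rw [bitrate]; split_ifs
      · exact min_le_left _ _
      · exact zero_le_one
    refine le_antisymm (ciSup_le hle) ?_
    rw [← (bitrate_eq_one_iff hs).mpr (hload s)]
    exact le_ciSup (Set.finite_range _).bddAbove s
  simp [minmaxBitrate, key]

/-! ### Growing a witness tree -/

/-- A witness tree with `m` edges for the initial state `ω`. It is a `d`-ary tree numbered as a
heap: its nodes are the distinct servers `f 0, …, f m`, its edges the distinct users
`g 0, …, g (m - 1)`, and the edge `g j` joins `f (j / d)` to its child `f (j + 1)`, both of which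
are candidates of `g j`. Siblings are listed by increasing edges, so that no tree is counted with
several orders of the same siblings. -/
structure IsTree {n : ℕ} (d m : ℕ) (ω : State n) (f g : ℕ → Fin n) : Prop where
  node_inj : ∀ i ≤ m, ∀ j ≤ m, f i = f j → i = j
  edge_inj : ∀ i < m, ∀ j < m, g i = g j → i = j
  parent_mem : ∀ j < m, f (j / d) ∈ ω (g j)
  child_mem : ∀ j < m, f (j + 1) ∈ ω (g j)
  sorted : ∀ i j, i < j → j < m → i / d = j / d → g i < g j

/-- The user `u` is a defect of a tree with `m` edges: among its candidates are the node
`f (m / d)`, the one whose children are being listed, and another node `f k`, although no edge at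
`f (m / d)` is `u`. -/
structure IsDefect {n : ℕ} (d m : ℕ) (ω : State n) (f g : ℕ → Fin n) (u : Fin n) (k : ℕ) :
    Prop where
  le : k ≤ m
  ne : f k ≠ f (m / d)
  node_mem : f (m / d) ∈ ω u
  other_mem : f k ∈ ω u
  not_incident : ∀ j < m, g j = u → j + 1 ≠ m / d ∧ j / d ≠ m / d

/-- A witness tree with two distinct defects. -/
def IsDefectiveTree {n : ℕ} (d m : ℕ) (ω : State n) (f g : ℕ → Fin n) (u₁ u₂ : Fin n)
    (k₁ k₂ : ℕ) : Prop :=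
  IsTree d m ω f g ∧ u₁ ≠ u₂ ∧ IsDefect d m ω f g u₁ k₁ ∧ IsDefect d m ω f g u₂ k₂

/-- The depth of the node with number `i` in a `d`-ary tree numbered as a heap. -/
def depth (d : ℕ) : ℕ → ℕ
  | 0 => 0
  | j + 1 => depth d (j / d) + 1
decreasing_by exact Nat.lt_succ_of_le (Nat.div_le_self j d)

lemma depth_le (d : ℕ) (hd : 2 ≤ d) (i : ℕ) : depth d i ≤ Nat.log d i + 1 := by
  induction i using Nat.strong_induction_on with
  | _ i ih =>
    rcases i with _ | j
    · simp [depth]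
    · rw [depth]
      rcases Nat.lt_or_ge j d with h | h
      · rw [Nat.div_eq_of_lt h]; simp [depth]
      · have h1 := ih (j / d) (Nat.lt_succ_of_le (Nat.div_le_self j d))
        have h2 : Nat.log d j = Nat.log d (j / d) + 1 := Nat.log_of_one_lt_of_le (by omega) h
        have h3 : Nat.log d j ≤ Nat.log d (j + 1) := Nat.log_mono_right (by omega)
        omega

/-- One more edge `u`, leading from the current node `f (m / d)` to a new server `s`. -/
lemma IsTree.snoc {n d m : ℕ} {ω : State n} {f g : ℕ → Fin n} (h : IsTree d m ω f g)
    {u s : Fin n} (hu : ∀ j < m, g j ≠ u) (hs : ∀ k ≤ m, f k ≠ s)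
    (hpu : f (m / d) ∈ ω u) (hsu : s ∈ ω u) (hlt : ∀ j < m, j / d = m / d → g j < u) :
    IsTree d (m + 1) ω (Function.update f (m + 1) s) (Function.update g m u) := by
  have hf : ∀ k ≤ m, Function.update f (m + 1) s k = f k := fun k hk =>
    Function.update_of_ne (by omega) _ _
  have hf' : Function.update f (m + 1) s (m + 1) = s := Function.update_self _ _ _
  have hg : ∀ j < m, Function.update g m u j = g j := fun k hk =>
    Function.update_of_ne (by omega) _ _
  have hg' : Function.update g m u m = u := Function.update_self _ _ _
  have hdiv : ∀ j, j / d ≤ j := fun j => Nat.div_le_self j d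
  refine ⟨fun i hi j hj hij => ?_, fun i hi j hj hij => ?_, fun j hj => ?_, fun j hj => ?_,
    fun i j hij hj hd => ?_⟩
  · rcases Nat.le_or_eq_of_le_succ hi with hi | rfl <;>
      rcases Nat.le_or_eq_of_le_succ hj with hj | rfl
    · rw [hf i hi, hf j hj] at hij; exact h.node_inj i hi j hj hij
    · rw [hf i hi, hf'] at hij; exact absurd hij (hs i hi)
    · rw [hf j hj, hf'] at hij; exact absurd hij.symm (hs j hj)
    · rfl
  · rcases Nat.lt_succ_iff_lt_or_eq.mp hi with hi | rfl <;>
      rcases Nat.lt_succ_iff_lt_or_eq.mp hj with hj | rfl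
    · rw [hg i hi, hg j hj] at hij; exact h.edge_inj i hi j hj hij
    · rw [hg i hi, hg'] at hij; exact absurd hij (hu i hi)
    · rw [hg j hj, hg'] at hij; exact absurd hij.symm (hu j hj)
    · rfl
  · rw [hf _ ((hdiv j).trans (by omega))]
    rcases Nat.lt_succ_iff_lt_or_eq.mp hj with hj | rfl
    · rw [hg j hj]; exact h.parent_mem j hj
    · rw [hg']; exact hpu
  · rcases Nat.lt_succ_iff_lt_or_eq.mp hj with hj | rfl
    · rw [hg j hj, hf _ (by omega)]; exact h.child_mem j hj
    · rw [hg', hf']; exact hsu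
  · rcases Nat.lt_succ_iff_lt_or_eq.mp hj with hj | rfl
    · rw [hg j hj, hg i (by omega)]; exact h.sorted i j hij hj hd
    · rw [hg', hg i hij]; exact hlt i hij hd

/-- Listing the children of the node `f p`. The users of `f p` other than the edge to its parent
are tried in increasing order; one that cannot serve as a new edge to a new server is a defect. As
there are `d + 1` of them, `d` children are found unless two defects turn up. -/
lemma IsTree.exists_defect_or_grow {n d : ℕ} {ω : State n} (hω : ∀ u, 2 ≤ (ω u).card)
    {A : ℕ → Set (Fin n)}
    (hA : ∀ t, ∀ v ∈ A (t + 1), ∃ U : Finset (Fin n), d + 2 ≤ U.card ∧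
      ∀ u ∈ U, v ∈ ω u ∧ ∀ s ∈ ω u, s ∈ A t)
    {h p : ℕ} (hp : depth d p < h) {f g : ℕ → Fin n} (hT : IsTree d (p * d) ω f g)
    (hd : 0 < d) (hfA : ∀ k ≤ p * d, f k ∈ A (h - depth d k)) :
    (∃ m < (p + 1) * d, ∃ f g u₁ u₂ k₁ k₂, IsDefectiveTree d m ω f g u₁ u₂ k₁ k₂) ∨
      ∃ f g, IsTree d ((p + 1) * d) ω f g ∧ ∀ k ≤ (p + 1) * d, f k ∈ A (h - depth d k) := by
  have hpd : p ≤ p * d := Nat.le_mul_of_pos_right p hd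
  obtain ⟨t, ht⟩ : ∃ t, h - depth d p = t + 1 := ⟨h - depth d p - 1, by omega⟩
  obtain ⟨U, hUc, hU⟩ := hA t (f p) (by rw [← ht]; exact hfA p hpd)
  obtain ⟨V, hVU, hVc⟩ : ∃ V ⊆ U.erase (g (p - 1)), V.card = d + 1 :=
    Finset.exists_subset_card_eq (by
      have := Finset.pred_card_le_card_erase (s := U) (a := g (p - 1)); omega)
  -- `W` is the set of the users tried so far
  have key : ∀ W : Finset (Fin n), W ⊆ V →
      (∃ m < (p + 1) * d, ∃ f g u₁ u₂ k₁ k₂, IsDefectiveTree d m ω f g u₁ u₂ k₁ k₂) ∨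
      (∃ f g, IsTree d ((p + 1) * d) ω f g ∧ ∀ k ≤ (p + 1) * d, f k ∈ A (h - depth d k)) ∨
      ∃ r < d, ∃ f' g', IsTree d (p * d + r) ω f' g' ∧
        (∀ k ≤ p * d + r, f' k ∈ A (h - depth d k)) ∧ f' p = f p ∧
        (0 < p → g' (p - 1) = g (p - 1)) ∧
        (∀ j, p * d ≤ j → j < p * d + r → g' j ∈ W) ∧
        (r = W.card ∨ r + 1 = W.card ∧ ∃ u ∈ W, ∃ k, IsDefect d (p * d + r) ω f' g' u k) := by
    intro W
    induction W using Finset.induction_on_max with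
    | empty =>
      intro _
      exact Or.inr (Or.inr ⟨0, hd, f, g, by simpa using hT, by simpa using hfA, rfl, fun _ => rfl,
        fun j h1 h2 => by omega, Or.inl (by simp)⟩)
    | insert a W hmax ih =>
      intro hW
      have haW : a ∉ W := fun ha => lt_irrefl _ (hmax a ha)
      have haV : a ∈ V := hW (Finset.mem_insert_self _ _)
      obtain ⟨hag, haU⟩ := Finset.mem_erase.mp (hVU haV)
      obtain ⟨hpa, hsA⟩ := hU a haU
      rcases ih fun x hx => hW (Finset.mem_insert_of_mem hx) with
        h1 | h1 | ⟨r, hr, f', g', hT', hfA', hfp, hgp, hgW, hcnt⟩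
      · exact Or.inl h1
      · exact Or.inr (Or.inl h1)
      have hm : (p * d + r) / d = p := by
        rw [Nat.add_comm, Nat.add_mul_div_right _ _ hd, Nat.div_eq_of_lt hr, Nat.zero_add]
      have hmlt : p * d + r < (p + 1) * d := by rw [Nat.add_mul]; omega
      -- the edges at `f p` are the one to its parent and those of the current block
      have hinc : ∀ j < p * d + r, g' j = a → j + 1 ≠ p ∧ j / d ≠ p := by
        rintro j hj rfl
        refine ⟨?_, fun h2 => haW (hgW j ?_ hj)⟩
        · rintro rfl; exact hag (hgp (by omega))
        · rw [← h2]; exact Nat.div_mul_le_self j d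
      by_cases hgood : (∀ j < p * d + r, g' j ≠ a) ∧
          ∃ s ∈ ω a, ∀ k ≤ p * d + r, f' k ≠ s
      · obtain ⟨hnew, s, hs, hsnew⟩ := hgood
        have hT'' := hT'.snoc hnew hsnew (by rw [hm, hfp]; exact hpa) hs (by
          rw [hm]
          intro j hj hjd
          exact hmax _ (hgW j (by rw [← hjd]; exact Nat.div_mul_le_self j d) hj))
        have hf : ∀ k ≤ p * d + r, Function.update f' (p * d + r + 1) s k = f' k := fun k hk =>
          Function.update_of_ne (by omega) _ _
        have hg : ∀ j < p * d + r, Function.update g' (p * d + r) a j = g' j := fun k hk =>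
          Function.update_of_ne (by omega) _ _
        have hfA'' : ∀ k ≤ p * d + r + 1,
            Function.update f' (p * d + r + 1) s k ∈ A (h - depth d k) := by
          intro k hk
          rcases Nat.le_or_eq_of_le_succ hk with hk | rfl
          · rw [hf k hk]; exact hfA' k hk
          · rw [Function.update_self, depth, hm, ← Nat.sub_sub, ht]
            exact hsA s hs
        rcases Nat.lt_or_ge (r + 1) d with hrd | hrd
        · refine Or.inr (Or.inr ⟨r + 1, hrd, _, _, hT'', hfA'', ?_, ?_, ?_, ?_⟩)
          · rw [hf p (by omega), hfp]
          · intro hp0; rw [hg _ (by omega), hgp hp0]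
          · intro j h1 h2
            rcases (by omega : j < p * d + r ∨ j = p * d + r) with h2 | rfl
            · rw [hg j h2]; exact Finset.mem_insert_of_mem (hgW j h1 h2)
            · rw [Function.update_self]; exact Finset.mem_insert_self _ _
          · rw [Finset.card_insert_of_notMem haW]
            rcases hcnt with hcnt | ⟨hcnt, u, hu, k, hk⟩
            · exact Or.inl (by omega)
            · refine Or.inr ⟨by omega, u, Finset.mem_insert_of_mem hu, k, ?_⟩
              have hm' : (p * d + (r + 1)) / d = p := by
                rw [Nat.add_comm, Nat.add_mul_div_right _ _ hd, Nat.div_eq_of_lt hrd, Nat.zero_add]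
              have hkm := hk.le
              have hfpe := hf p (by omega)
              refine ⟨by omega, ?_, ?_, ?_, ?_⟩
              · rw [hm', hfpe, hf k hkm]; simpa [hm] using hk.ne
              · rw [hm', hfpe]; simpa [hm] using hk.node_mem
              · rw [hf k hkm]; exact hk.other_mem
              · intro j hj hju
                rw [hm']
                rcases (by omega : j < p * d + r ∨ j = p * d + r) with hj | rfl
                · rw [hg j hj] at hju; simpa [hm] using hk.not_incident j hj hju
                · rw [Function.update_self] at hju
                  exact absurd (hju ▸ hu) haW
        · have hfull : p * d + r + 1 = (p + 1) * d := by rw [Nat.add_mul]; omega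
          exact Or.inr (Or.inl ⟨_, _, hfull ▸ hT'', hfull ▸ hfA''⟩)
      · have hdef : ∃ k, IsDefect d (p * d + r) ω f' g' a k := by
          by_cases hused : ∃ j < p * d + r, g' j = a
          · obtain ⟨j, hj, hja⟩ := hused
            have hjm : j / d ≤ p * d + r := (Nat.div_le_self j d).trans hj.le
            refine ⟨j / d, hjm, ?_, ?_, ?_, ?_⟩
            · rw [hm]
              exact fun he => (hinc j hj hja).2 (hT'.node_inj _ hjm _ (by omega) he)
            · rw [hm, hfp]; exact hpa
            · rw [← hja]; exact hT'.parent_mem j hj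
            · rw [hm]; exact hinc
          · push Not at hused
            obtain ⟨s, hs, hsp⟩ := Finset.exists_mem_ne (hω a) (f p)
            have hex : ∃ k ≤ p * d + r, f' k = s := by
              by_contra hcon
              push Not at hcon
              exact hgood ⟨hused, s, hs, hcon⟩
            obtain ⟨k, hk, rfl⟩ := hex
            refine ⟨k, hk, ?_, ?_, hs, ?_⟩
            · rw [hm, hfp]; exact hsp
            · rw [hm, hfp]; exact hpa
            · rw [hm]; exact hinc
        obtain ⟨k, hk⟩ := hdef
        rcases hcnt with hcnt | ⟨hcnt, u, hu, k', hk'⟩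
        · refine Or.inr (Or.inr ⟨r, hr, f', g', hT', hfA', hfp, hgp,
            fun j h1 h2 => Finset.mem_insert_of_mem (hgW j h1 h2), Or.inr ⟨?_, a,
              Finset.mem_insert_self _ _, k, hk⟩⟩)
          rw [Finset.card_insert_of_notMem haW, hcnt]
        · exact Or.inl ⟨_, hmlt, f', g', u, a, k', k, hT', fun he => haW (he ▸ hu), hk', hk⟩
  rcases key V subset_rfl with h1 | h1 | ⟨r, hr, -, -, -, -, -, -, -, hcnt | ⟨hcnt, -⟩⟩
  · exact Or.inl h1
  · exact Or.inr h1
  · omega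
  · omega

/-- A server that survives for more rounds than the depth of the first `P` nodes of a heap is the
root of a witness tree with `P * d` edges, unless a smaller tree is defective. -/
lemma exists_defect_or_tree {n d : ℕ} {ω : State n} (hω : ∀ u, 2 ≤ (ω u).card)
    {A : ℕ → Set (Fin n)}
    (hA : ∀ t, ∀ v ∈ A (t + 1), ∃ U : Finset (Fin n), d + 2 ≤ U.card ∧
      ∀ u ∈ U, v ∈ ω u ∧ ∀ s ∈ ω u, s ∈ A t)
    (hd : 0 < d) {h P : ℕ} (hP : ∀ i < P, depth d i < h) {v : Fin n} (hv : v ∈ A h) :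
    (∃ m < P * d, ∃ f g u₁ u₂ k₁ k₂, IsDefectiveTree d m ω f g u₁ u₂ k₁ k₂) ∨
      ∃ f g, IsTree d (P * d) ω f g := by
  have key : ∀ p ≤ P, (∃ m < p * d, ∃ f g u₁ u₂ k₁ k₂, IsDefectiveTree d m ω f g u₁ u₂ k₁ k₂) ∨
      ∃ f g, IsTree d (p * d) ω f g ∧ ∀ k ≤ p * d, f k ∈ A (h - depth d k) := by
    intro p
    induction p with
    | zero =>
      intro _
      refine Or.inr ⟨fun _ => v, fun _ => v, ⟨?_, ?_, ?_, ?_, ?_⟩, ?_⟩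
      · intro i hi j hj _; omega
      · intro i hi; omega
      · intro i hi; omega
      · intro i hi; omega
      · intro i j _ hj; omega
      · intro k hk
        obtain rfl : k = 0 := by omega
        simpa [depth] using hv
    | succ p ih =>
      intro hp
      rcases ih (by omega) with ⟨m, hm, h1⟩ | ⟨f, g, hT, hfA⟩
      · exact Or.inl ⟨m, hm.trans_le (Nat.mul_le_mul_right d (by omega)), h1⟩
      · exact hT.exists_defect_or_grow hω hA (hP p (by omega)) hd hfA
  rcases key P le_rfl with h1 | ⟨f, g, hT, -⟩
  · exact Or.inl h1
  · exact Or.inr ⟨f, g, hT⟩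

/-! ### The law of the initial state -/

lemma setOf_card_eq (n σ : ℕ) : {A : Finset (Fin n) | A.card = σ} =
    ((Finset.powersetCard σ Finset.univ : Finset (Finset (Fin n))) : Set (Finset (Fin n))) := by
  ext A; simp [Finset.mem_powersetCard]

lemma isProbabilityMeasure_candidates {n σ : ℕ} (h : σ ≤ n) :
    IsProbabilityMeasure (uniformOn {A : Finset (Fin n) | A.card = σ}) := by
  refine isProbabilityMeasure_uniformOn (Set.toFinite _) ?_
  rw [setOf_card_eq]
  exact_mod_cast Finset.powersetCard_nonempty.mpr (by simpa using h)

lemma isProbabilityMeasure_initialLaw {n σ : ℕ} (h : σ ≤ n) :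
    IsProbabilityMeasure (initialLaw n σ) := by
  have := isProbabilityMeasure_candidates h
  rw [initialLaw]
  infer_instance

lemma card_powersetCard_superset_le {n : ℕ} (σ : ℕ) (A : Finset (Fin n)) :
    ((Finset.powersetCard σ Finset.univ).filter fun S => A ⊆ S).card ≤
      (n - A.card).choose (σ - A.card) := by
  have hc : (n - A.card).choose (σ - A.card) =
      (Finset.powersetCard (σ - A.card) Aᶜ).card := by
    rw [Finset.card_powersetCard, Finset.card_compl, Fintype.card_fin]
  rw [hc]
  refine Finset.card_le_card_of_injOn (fun S => S \ A) (fun S hS => ?_) fun S hS S' hS' hSS => ?_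
  · simp only [Finset.coe_filter, Finset.mem_powersetCard, Finset.subset_univ, true_and,
      Set.mem_ofPred_eq] at hS
    simp only [Finset.mem_coe, Finset.mem_powersetCard]
    exact ⟨fun x hx => by simp at hx; simp [hx.2], by rw [Finset.card_sdiff_of_subset hS.2, hS.1]⟩
  · simp only [Finset.coe_filter, Set.mem_ofPred_eq] at hS hS'
    rw [← Finset.sdiff_union_of_subset hS.2, ← Finset.sdiff_union_of_subset hS'.2]
    simp only at hSS
    rw [hSS]

/-- The probability that the candidates of a user include a given set of servers. -/
lemma candidates_real_superset_le {n σ : ℕ} (hn : σ ≤ n) (A : Finset (Fin n)) :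
    (uniformOn {A : Finset (Fin n) | A.card = σ}).real {S | A ⊆ S} ≤
      (σ.choose A.card : ℝ) / (n.choose A.card : ℝ) := by
  classical
  have hset : {S : Finset (Fin n) | A ⊆ S} =
      ((Finset.univ.filter fun S => A ⊆ S : Finset (Finset (Fin n))) : Set _) := by
    ext; simp
  have hint : (Finset.powersetCard σ Finset.univ ∩ Finset.univ.filter fun S => A ⊆ S) =
      (Finset.powersetCard σ Finset.univ).filter fun S => A ⊆ S := by
    ext; simp
  rw [measureReal_def, setOf_card_eq, hset, uniformOn_apply_finset, hint, ENNReal.toReal_div,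
    ENNReal.toReal_natCast, ENNReal.toReal_natCast, Finset.card_powersetCard, Finset.card_univ,
    Fintype.card_fin]
  have hA : A.card ≤ n := by simpa using Finset.card_le_univ A
  have hpos : (0 : ℝ) < n.choose σ := by exact_mod_cast Nat.choose_pos hn
  have hpos' : (0 : ℝ) < n.choose A.card := by exact_mod_cast Nat.choose_pos hA
  rw [div_le_div_iff₀ hpos hpos']
  rcases le_or_gt A.card σ with h | h
  · have h1 := card_powersetCard_superset_le σ A
    have h2 := Nat.choose_mul (n := n) h
    calc _ ≤ ((n - A.card).choose (σ - A.card) : ℝ) * (n.choose A.card : ℝ) := by gcongr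
      _ = _ := by rw [mul_comm]; norm_cast; rw [← h2, mul_comm]
  · have : ((Finset.powersetCard σ Finset.univ).filter fun S : Finset (Fin n) => A ⊆ S) = ∅ := by
      refine Finset.filter_eq_empty_iff.mpr fun S hS hAS => ?_
      have := Finset.card_le_card hAS
      simp only [Finset.mem_powersetCard, Finset.subset_univ, true_and] at hS
      omega
    rw [this]
    simp only [Finset.card_empty, Nat.cast_zero, zero_mul]
    positivity

/-- The probability that two given servers are candidates of a given user. -/
noncomputable def edgeProb (n σ : ℕ) : ℝ := σ * (σ - 1) / (n * (n - 1))

lemma edgeProb_nonneg {n σ : ℕ} (hσ : 1 ≤ σ) (hn : 1 ≤ n) : 0 ≤ edgeProb n σ := by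
  have h1 : (1 : ℝ) ≤ σ := by exact_mod_cast hσ
  have h2 : (1 : ℝ) ≤ n := by exact_mod_cast hn
  exact div_nonneg (mul_nonneg (by linarith) (by linarith)) (mul_nonneg (by linarith) (by linarith))

lemma candidates_real_pair_le {n σ : ℕ} (hn : σ ≤ n) {a b : Fin n} (hab : a ≠ b)
    {E : Set (Finset (Fin n))} (hE : ∀ S ∈ E, a ∈ S ∧ b ∈ S) :
    (uniformOn {A : Finset (Fin n) | A.card = σ}).real E ≤ edgeProb n σ := by
  have := isProbabilityMeasure_candidates hn
  have h := candidates_real_superset_le hn {a, b}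
  rw [Finset.card_pair hab, Nat.cast_choose_two, Nat.cast_choose_two, div_div_div_cancel_right₀
    (by norm_num)] at h
  refine (measureReal_mono fun S hS => ?_).trans h
  simpa [Finset.insert_subset_iff] using hE S hS

lemma candidates_real_triple_le {n σ : ℕ} (hσ : 2 ≤ σ) (hn : σ ≤ n) {a b c : Fin n} (hab : a ≠ b)
    (hac : a ≠ c) (hbc : b ≠ c) {E : Set (Finset (Fin n))}
    (hE : ∀ S ∈ E, a ∈ S ∧ b ∈ S ∧ c ∈ S) :
    (uniformOn {A : Finset (Fin n) | A.card = σ}).real E ≤ edgeProb n σ * (σ / n) := by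
  have := isProbabilityMeasure_candidates hn
  have h := candidates_real_superset_le hn {a, b, c}
  have hc : ({a, b, c} : Finset (Fin n)).card = 3 := Finset.card_eq_three.mpr
    ⟨a, b, c, hab, hac, hbc, rfl⟩
  have hn3 : 3 ≤ n := by
    have := Finset.card_le_univ ({a, b, c} : Finset (Fin n))
    rw [hc, Fintype.card_fin] at this; exact this
  rw [hc] at h
  have cast3 : ∀ k : ℕ, 2 ≤ k → (k.choose 3 : ℝ) = k * (k - 1) * (k - 2) / 6 := fun k hk => by
    have h3 := Nat.add_one_mul_choose_eq (k - 1) 2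
    have hk1 : k - 1 + 1 = k := by omega
    have h2 := Nat.cast_choose_two ℝ (k - 1)
    rw [Nat.cast_sub (by omega), Nat.cast_one] at h2
    rw [hk1] at h3
    have h4 : (k : ℝ) * ((k - 1).choose 2 : ℝ) = (k.choose 3 : ℝ) * 3 := by exact_mod_cast h3
    rw [h2] at h4
    linarith
  rw [cast3 σ hσ, cast3 n (by omega), div_div_div_cancel_right₀ (by norm_num)] at h
  have hle : (uniformOn {A : Finset (Fin n) | A.card = σ}).real E ≤
      (uniformOn {A : Finset (Fin n) | A.card = σ}).real {S | {a, b, c} ⊆ S} :=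
    measureReal_mono fun S hS => by simpa [Finset.insert_subset_iff] using hE S hS
  refine hle.trans (h.trans ?_)
  rw [mul_div_mul_comm]
  have h3 : (3 : ℝ) ≤ n := by exact_mod_cast hn3
  have hσn : (σ : ℝ) ≤ n := by exact_mod_cast hn
  refine mul_le_mul_of_nonneg_left ?_ (edgeProb_nonneg (by omega) (by omega))
  rw [div_le_div_iff₀ (by linarith) (by linarith)]
  linarith

lemma initialLaw_real_forall_mem {n σ : ℕ} (hn : σ ≤ n) (E : Fin n → Set (Finset (Fin n))) :
    (initialLaw n σ).real {ω | ∀ u, ω u ∈ E u} =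
      ∏ u, (uniformOn {A : Finset (Fin n) | A.card = σ}).real (E u) := by
  have := isProbabilityMeasure_candidates hn
  have hset : {ω : State n | ∀ u, ω u ∈ E u} = Set.univ.pi E := by ext; simp
  rw [hset, measureReal_def, initialLaw, Measure.pi_pi, ENNReal.toReal_prod]
  rfl

lemma initialLaw_real_card_ne (n σ : ℕ) :
    (initialLaw n σ).real {ω | ∀ u, (ω u).card = σ}ᶜ = 0 := by
  have h : initialLaw n σ = uniformOn (Set.univ.pi fun _ => {A : Finset (Fin n) | A.card = σ}) :=
    uniformOn_pi.symm
  have hset : {ω : State n | ∀ u, (ω u).card = σ} =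
      Set.univ.pi fun _ => {A : Finset (Fin n) | A.card = σ} := by ext; simp
  rw [measureReal_def, h, (uniformOn_eq_zero_iff (Set.toFinite _)).mpr, ENNReal.toReal_zero]
  rw [hset, Set.inter_compl_self]

/-! ### The expected number of witness trees -/

/-- The probability factor of a defect `u` of a tree with edges `g 0, …, g (m - 1)`: a third
candidate for an edge of the tree, two candidates for any other user. -/
noncomputable def defectProb {n : ℕ} (σ m : ℕ) (g : ℕ → Fin n) (u : Fin n) : ℝ :=
  if u ∈ (Finset.range m).image g then (σ : ℝ) / n else edgeProb n σ

lemma defectProb_nonneg {n σ m : ℕ} (hσ : 1 ≤ σ) (hn : 1 ≤ n) (g : ℕ → Fin n) (u : Fin n) :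
    0 ≤ defectProb σ m g u := by
  rw [defectProb]; split_ifs
  · positivity
  · exact edgeProb_nonneg hσ hn

/-- The probability that given nodes and edges form a tree in which the users in `D` are
defects. -/
lemma initialLaw_real_tree_le {n σ d m : ℕ} (hσ : 2 ≤ σ) (hn : σ ≤ n) {f g : ℕ → Fin n}
    (hf : ∀ i ≤ m, ∀ j ≤ m, f i = f j → i = j) (hg : ∀ i < m, ∀ j < m, g i = g j → i = j)
    (D : Finset (Fin n)) (k : Fin n → ℕ)
    (hD : ∀ u ∈ D, f (k u) ≠ f (m / d) ∧ ∀ j < m, g j = u → j + 1 ≠ m / d ∧ j / d ≠ m / d) :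
    (initialLaw n σ).real {ω | ∀ u, ω u ∈ {S : Finset (Fin n) |
        (∀ j < m, g j = u → f (j / d) ∈ S ∧ f (j + 1) ∈ S) ∧
        (u ∈ D → f (m / d) ∈ S ∧ f (k u) ∈ S)}} ≤
      edgeProb n σ ^ m * ∏ u ∈ D, defectProb σ m g u := by
  have := isProbabilityMeasure_candidates hn
  have hq : 0 ≤ edgeProb n σ := edgeProb_nonneg (by omega) (by omega)
  have hcard : ((Finset.range m).image g).card = m := by
    rw [Finset.card_image_of_injOn, Finset.card_range]
    intro i hi j hj hij
    exact hg i (by simpa using hi) j (by simpa using hj) hij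
  rw [initialLaw_real_forall_mem hn]
  calc _ ≤ ∏ u : Fin n, ((if u ∈ (Finset.range m).image g then edgeProb n σ else 1) *
        (if u ∈ D then defectProb σ m g u else 1)) := by
        refine Finset.prod_le_prod (fun _ _ => measureReal_nonneg) fun u _ => ?_
        by_cases hu : u ∈ (Finset.range m).image g
        · obtain ⟨j, hj, hju⟩ := Finset.mem_image.mp hu
          have hj : j < m := by simpa using hj
          have hdiv : j / d ≤ j := Nat.div_le_self j d
          have hmdiv : m / d ≤ m := Nat.div_le_self m d
          have hne : f (j / d) ≠ f (j + 1) := fun h => by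
            have := hf _ (by omega) _ (by omega) h; omega
          by_cases huD : u ∈ D
          · obtain ⟨h1, h2⟩ := (hD u huD).2 j hj hju
            rw [if_pos hu, if_pos huD, defectProb, if_pos hu]
            refine candidates_real_triple_le hσ hn hne (c := f (m / d)) ?_ ?_
              fun S hS => ⟨(hS.1 j hj hju).1, (hS.1 j hj hju).2, (hS.2 huD).1⟩
            · exact fun h => h2 (hf _ (by omega) _ hmdiv h)
            · exact fun h => h1 (hf _ (by omega) _ hmdiv h)
          · rw [if_pos hu, if_neg huD, mul_one]
            exact candidates_real_pair_le hn hne fun S hS => hS.1 j hj hju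
        · by_cases huD : u ∈ D
          · rw [if_neg hu, if_pos huD, one_mul, defectProb, if_neg hu]
            exact candidates_real_pair_le hn (hD u huD).1.symm fun S hS => hS.2 huD
          · rw [if_neg hu, if_neg huD, one_mul]
            exact measureReal_le_one
    _ = _ := by
        rw [Finset.prod_mul_distrib, Finset.prod_ite_mem, Finset.univ_inter, Finset.prod_ite_mem,
          Finset.univ_inter, Finset.prod_const, hcard]

lemma initialLaw_real_isTree_le {n σ d m : ℕ} (hσ : 2 ≤ σ) (hn : σ ≤ n) (f g : ℕ → Fin n) :
    (initialLaw n σ).real {ω | IsTree d m ω f g} ≤ edgeProb n σ ^ m := by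
  have := isProbabilityMeasure_initialLaw hn
  rcases Set.eq_empty_or_nonempty {ω | IsTree d m ω f g} with h | ⟨ω₀, h₀⟩
  · rw [h, measureReal_empty]
    exact pow_nonneg (edgeProb_nonneg (by omega) (by omega)) _
  · have h := initialLaw_real_tree_le (d := d) hσ hn h₀.node_inj h₀.edge_inj ∅ (fun _ => 0) (by simp)
    rw [Finset.prod_empty, mul_one] at h
    refine (measureReal_mono fun ω hω u => ?_).trans h
    have hω : IsTree d m ω f g := hω
    refine ⟨?_, by simp⟩
    rintro j hj rfl
    exact ⟨hω.parent_mem j hj, hω.child_mem j hj⟩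

lemma initialLaw_real_isDefectiveTree_le {n σ d m : ℕ} (hσ : 2 ≤ σ) (hn : σ ≤ n)
    (f g : ℕ → Fin n) (u₁ u₂ : Fin n) (k₁ k₂ : ℕ) :
    (initialLaw n σ).real {ω | IsDefectiveTree d m ω f g u₁ u₂ k₁ k₂} ≤
      edgeProb n σ ^ m * (defectProb σ m g u₁ * defectProb σ m g u₂) := by
  have := isProbabilityMeasure_initialLaw hn
  rcases Set.eq_empty_or_nonempty {ω | IsDefectiveTree d m ω f g u₁ u₂ k₁ k₂} with
    h | ⟨ω₀, hT, hne, h1, h2⟩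
  · rw [h, measureReal_empty]
    have hq := fun u => defectProb_nonneg (σ := σ) (m := m) (by omega) (by omega) g u
    exact mul_nonneg (pow_nonneg (edgeProb_nonneg (by omega) (by omega)) _)
      (mul_nonneg (hq _) (hq _))
  · have h := initialLaw_real_tree_le (d := d) hσ hn hT.node_inj hT.edge_inj {u₁, u₂}
      (fun u => if u = u₁ then k₁ else k₂) (by
        intro u hu
        rcases Finset.mem_insert.mp hu with rfl | hu
        · exact ⟨by simpa using h1.ne, h1.not_incident⟩
        · obtain rfl := Finset.mem_singleton.mp hu
          exact ⟨by simpa [hne.symm] using h2.ne, h2.not_incident⟩)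
    rw [Finset.prod_pair hne] at h
    refine (measureReal_mono fun ω hω u => ?_).trans h
    obtain ⟨hT, -, h1, h2⟩ := hω
    refine ⟨?_, fun hu => ?_⟩
    · rintro j hj rfl
      exact ⟨hT.parent_mem j hj, hT.child_mem j hj⟩
    · rcases Finset.mem_insert.mp hu with rfl | hu
      · exact ⟨h1.node_mem, by simpa using h1.other_mem⟩
      · obtain rfl := Finset.mem_singleton.mp hu
        exact ⟨h2.node_mem, by simpa [hne.symm] using h2.other_mem⟩

/-- The lists of `m` users in which siblings are listed in increasing order. -/
def sortedEdges (n d m : ℕ) : Finset (Fin m → Fin n) :=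
  Finset.univ.filter fun g => ∀ i j : Fin m, i < j → (i : ℕ) / d = (j : ℕ) / d → g i < g j

lemma card_sortedEdges_add_le (n : ℕ) {d p r : ℕ} (hr : r ≤ d) :
    (sortedEdges n d (p * d + r)).card ≤ (sortedEdges n d (p * d)).card * n.choose r := by
  have hc : n.choose r = (Finset.powersetCard r (Finset.univ : Finset (Fin n))).card := by simp
  have hmono : ∀ g ∈ sortedEdges n d (p * d + r), StrictMono fun i : Fin r => g (Fin.natAdd _ i) := by
    intro g hg i j hij
    have hd : 0 < d := by have := i.isLt; omega
    simp only [sortedEdges, Finset.mem_filter, Finset.mem_univ, true_and] at hg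
    have hdiv : ∀ i : Fin r, (p * d + (i : ℕ)) / d = p := fun i => by
      rw [Nat.add_comm, Nat.add_mul_div_right _ _ hd, Nat.div_eq_of_lt (by omega), Nat.zero_add]
    exact hg _ _ (by simpa using hij) (by simp [hdiv])
  rw [hc, ← Finset.card_product]
  refine Finset.card_le_card_of_injOn
    (fun g => (fun i => g (Fin.castAdd r i), Finset.univ.image fun i : Fin r => g (Fin.natAdd _ i)))
    (fun g hg => ?_) fun g hg g' hg' hgg => ?_
  · have hm := hmono g hg
    simp only [sortedEdges, Finset.coe_filter, Finset.mem_univ, true_and, Set.mem_ofPred_eq] at hg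
    simp only [sortedEdges, Finset.coe_product, Set.mem_prod, Finset.coe_filter, Finset.mem_univ,
      true_and, Set.mem_ofPred_eq, Finset.mem_coe, Finset.mem_powersetCard, Finset.subset_univ]
    exact ⟨fun i j hij hd => hg _ _ (Fin.lt_def.mpr (Fin.lt_def.mp hij)) (by simpa using hd),
      by rw [Finset.card_image_of_injective _ hm.injective, Finset.card_univ, Fintype.card_fin]⟩
  · obtain ⟨h1, h2⟩ := Prod.mk.injEq .. ▸ hgg
    have h3 := (StrictMono.range_inj (hmono g hg) (hmono g' hg')).mp (by
      have := congrArg (fun s : Finset (Fin n) => (s : Set (Fin n))) h2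
      simpa using this)
    funext i
    refine Fin.addCases (fun i => congrFun h1 i) (fun i => congrFun h3 i) i

lemma card_sortedEdges_le (n : ℕ) {d r : ℕ} (p : ℕ) (hr : r ≤ d) :
    ((sortedEdges n d (p * d + r)).card : ℝ) ≤
      (n : ℝ) ^ (p * d + r) / ((d.factorial : ℝ) ^ p * r.factorial) := by
  have hblocks : ∀ p : ℕ, ((sortedEdges n d (p * d)).card : ℝ) ≤
      (n : ℝ) ^ (p * d) / (d.factorial : ℝ) ^ p := by
    intro p
    induction p with
    | zero =>
      have h0 : (sortedEdges n d (0 * d)).card ≤ 1 := by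
        refine (Finset.card_le_univ _).trans ?_
        simp
      simpa using h0
    | succ p ih =>
      have h1 : ((sortedEdges n d ((p + 1) * d)).card : ℝ) ≤
          (sortedEdges n d (p * d)).card * (n.choose d : ℝ) := by
        have := card_sortedEdges_add_le n (d := d) (p := p) le_rfl
        rw [← Nat.succ_mul] at this
        exact_mod_cast this
      calc _ ≤ _ := h1
        _ ≤ (n : ℝ) ^ (p * d) / (d.factorial : ℝ) ^ p * ((n : ℝ) ^ d / d.factorial) := by
          gcongr
          exact Nat.choose_le_pow_div d n
        _ = _ := by rw [div_mul_div_comm, ← pow_add, ← pow_succ, Nat.add_mul, Nat.one_mul]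
  have h1 : ((sortedEdges n d (p * d + r)).card : ℝ) ≤
      (sortedEdges n d (p * d)).card * (n.choose r : ℝ) := by
    exact_mod_cast card_sortedEdges_add_le n hr
  calc _ ≤ _ := h1
    _ ≤ (n : ℝ) ^ (p * d) / (d.factorial : ℝ) ^ p * ((n : ℝ) ^ r / r.factorial) := by
      gcongr
      · exact hblocks p
      · exact Nat.choose_le_pow_div r n
    _ = _ := by rw [div_mul_div_comm, ← pow_add]

/-- A finite list, continued by `0`. -/
def extendByZero {n m : ℕ} [NeZero n] (f : Fin m → Fin n) (i : ℕ) : Fin n :=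
  if h : i < m then f ⟨i, h⟩ else 0

lemma extendByZero_restrict {n m : ℕ} [NeZero n] (f : ℕ → Fin n) {i : ℕ} (h : i < m) :
    extendByZero (fun j : Fin m => f j) i = f i := by
  rw [extendByZero, dif_pos h]

lemma IsTree.congr {n d m : ℕ} {ω : State n} {f g f' g' : ℕ → Fin n} (h : IsTree d m ω f g)
    (hf : ∀ i ≤ m, f' i = f i) (hg : ∀ j < m, g' j = g j) : IsTree d m ω f' g' := by
  refine ⟨fun i hi j hj hij => ?_, fun i hi j hj hij => ?_, fun j hj => ?_, fun j hj => ?_,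
    fun i j hij hj hd => ?_⟩
  · rw [hf i hi, hf j hj] at hij; exact h.node_inj i hi j hj hij
  · rw [hg i hi, hg j hj] at hij; exact h.edge_inj i hi j hj hij
  · rw [hf _ ((Nat.div_le_self j d).trans hj.le), hg j hj]; exact h.parent_mem j hj
  · rw [hf _ hj, hg j hj]; exact h.child_mem j hj
  · rw [hg i (hij.trans hj), hg j hj]; exact h.sorted i j hij hj hd

lemma IsDefect.congr {n d m : ℕ} {ω : State n} {f g f' g' : ℕ → Fin n} {u : Fin n} {k : ℕ}
    (h : IsDefect d m ω f g u k) (hf : ∀ i ≤ m, f' i = f i) (hg : ∀ j < m, g' j = g j) :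
    IsDefect d m ω f' g' u k := by
  have hm := hf _ (Nat.div_le_self m d)
  have hk := hf k h.le
  exact ⟨h.le, by rw [hm, hk]; exact h.ne, by rw [hm]; exact h.node_mem,
    by rw [hk]; exact h.other_mem, fun j hj hju => h.not_incident j hj (by rwa [hg j hj] at hju)⟩

lemma IsTree.restrict_mem_sortedEdges {n d m : ℕ} {ω : State n} {f g : ℕ → Fin n}
    (h : IsTree d m ω f g) : (fun j : Fin m => g j) ∈ sortedEdges n d m := by
  simp only [sortedEdges, Finset.mem_filter, Finset.mem_univ, true_and]
  exact fun i j hij hd => h.sorted i j hij j.isLt hd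

lemma initialLaw_real_exists_isTree_le_card {n σ d m : ℕ} [NeZero n] (hσ : 2 ≤ σ) (hn : σ ≤ n) :
    (initialLaw n σ).real {ω | ∃ f g, IsTree d m ω f g} ≤
      (n : ℝ) ^ (m + 1) * (sortedEdges n d m).card * edgeProb n σ ^ m := by
  have := isProbabilityMeasure_initialLaw hn
  let I : Finset ((Fin (m + 1) → Fin n) × (Fin m → Fin n)) := Finset.univ ×ˢ sortedEdges n d m
  have hsub : {ω | ∃ f g, IsTree d m ω f g} ⊆
      ⋃ x ∈ I, {ω | IsTree d m ω (extendByZero x.1) (extendByZero x.2)} := by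
    rintro ω ⟨f, g, h⟩
    simp only [Set.mem_iUnion]
    refine ⟨(fun i => f i, fun j => g j), ?_, ?_⟩
    · exact Finset.mem_product.mpr ⟨Finset.mem_univ _, h.restrict_mem_sortedEdges⟩
    · exact h.congr (fun i hi => extendByZero_restrict f (Nat.lt_succ_of_le hi))
        fun j hj => extendByZero_restrict g hj
  calc _ ≤ _ := measureReal_mono hsub (measure_ne_top _ _)
    _ ≤ ∑ x ∈ I, (initialLaw n σ).real
        {ω | IsTree d m ω (extendByZero x.1) (extendByZero x.2)} :=
      measureReal_biUnion_finset_le _ _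
    _ ≤ ∑ _x ∈ I, edgeProb n σ ^ m :=
      Finset.sum_le_sum fun x _ => initialLaw_real_isTree_le hσ hn _ _
    _ = _ := by
      rw [Finset.sum_const, Finset.card_product, nsmul_eq_mul]
      simp

lemma sum_defectProb_le {n σ m : ℕ} (hσ : 1 ≤ σ) (hn : 1 ≤ n) (g : ℕ → Fin n) :
    ∑ u, defectProb σ m g u ≤ m * ((σ : ℝ) / n) + n * edgeProb n σ := by
  have hq := edgeProb_nonneg hσ hn
  have h1 : (((Finset.range m).image g).card : ℝ) ≤ m := by
    exact_mod_cast Finset.card_image_le.trans (by simp)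
  calc ∑ u, defectProb σ m g u
      ≤ ∑ u : Fin n, ((if u ∈ (Finset.range m).image g then (σ : ℝ) / n else 0) +
          edgeProb n σ) := by
        refine Finset.sum_le_sum fun u _ => ?_
        rw [defectProb]
        split_ifs
        · linarith
        · linarith
    _ = ((Finset.range m).image g).card * ((σ : ℝ) / n) + n * edgeProb n σ := by
        rw [Finset.sum_add_distrib, Finset.sum_ite_mem, Finset.univ_inter, Finset.sum_const,
          Finset.sum_const, Finset.card_univ, Fintype.card_fin, nsmul_eq_mul, nsmul_eq_mul]
    _ ≤ _ := by gcongr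

lemma initialLaw_real_exists_isDefectiveTree_le_card {n σ d m : ℕ} [NeZero n] (hσ : 2 ≤ σ)
    (hn : σ ≤ n) :
    (initialLaw n σ).real {ω | ∃ f g u₁ u₂ k₁ k₂, IsDefectiveTree d m ω f g u₁ u₂ k₁ k₂} ≤
      (n : ℝ) ^ (m + 1) * (sortedEdges n d m).card * edgeProb n σ ^ m *
        ((m + 1) * (m * ((σ : ℝ) / n) + n * edgeProb n σ)) ^ 2 := by
  have := isProbabilityMeasure_initialLaw hn
  have hq := edgeProb_nonneg (n := n) (σ := σ) (by omega) (by omega)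
  let I : Finset ((Fin (m + 1) → Fin n) × (Fin m → Fin n)) := Finset.univ ×ˢ sortedEdges n d m
  let J : Finset ((Fin n × Fin (m + 1)) × (Fin n × Fin (m + 1))) := Finset.univ ×ˢ Finset.univ
  have hJ : ∀ F : Fin n → ℝ, ∑ z ∈ J, F z.1.1 * F z.2.1 = ((m + 1) * ∑ u, F u) ^ 2 := fun F => by
    have h1 : ∑ y : Fin n × Fin (m + 1), F y.1 = (m + 1) * ∑ u, F u := by
      rw [← Finset.univ_product_univ, Finset.sum_product]
      simp [Finset.mul_sum]
    rw [sq, ← h1, Finset.sum_mul_sum, ← Finset.sum_product']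
  have hsub : {ω | ∃ f g u₁ u₂ k₁ k₂, IsDefectiveTree d m ω f g u₁ u₂ k₁ k₂} ⊆
      ⋃ x ∈ I ×ˢ J, {ω | IsDefectiveTree d m ω (extendByZero x.1.1) (extendByZero x.1.2)
        x.2.1.1 x.2.2.1 x.2.1.2 x.2.2.2} := by
    rintro ω ⟨f, g, u₁, u₂, k₁, k₂, hT, hne, h1, h2⟩
    have hf : ∀ i ≤ m, extendByZero (fun j : Fin (m + 1) => f j) i = f i :=
      fun i hi => extendByZero_restrict f (Nat.lt_succ_of_le hi)
    have hg : ∀ j < m, extendByZero (fun j : Fin m => g j) j = g j :=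
      fun j hj => extendByZero_restrict g hj
    simp only [Set.mem_iUnion]
    refine ⟨((fun i => f i, fun j => g j), ((u₁, ⟨k₁, Nat.lt_succ_of_le h1.le⟩),
      (u₂, ⟨k₂, Nat.lt_succ_of_le h2.le⟩))), ?_, ?_⟩
    · simp only [I, J, Finset.mem_product, Finset.mem_univ, true_and, and_true]
      exact hT.restrict_mem_sortedEdges
    · exact ⟨hT.congr hf hg, hne, h1.congr hf hg, h2.congr hf hg⟩
  calc _ ≤ _ := measureReal_mono hsub (measure_ne_top _ _)
    _ ≤ ∑ x ∈ I ×ˢ J, (initialLaw n σ).real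
        {ω | IsDefectiveTree d m ω (extendByZero x.1.1) (extendByZero x.1.2)
          x.2.1.1 x.2.2.1 x.2.1.2 x.2.2.2} :=
      measureReal_biUnion_finset_le _ _
    _ ≤ ∑ x ∈ I ×ˢ J, edgeProb n σ ^ m * (defectProb σ m (extendByZero x.1.2) x.2.1.1 *
          defectProb σ m (extendByZero x.1.2) x.2.2.1) :=
      Finset.sum_le_sum fun x _ => initialLaw_real_isDefectiveTree_le hσ hn _ _ _ _ _ _
    _ = ∑ y ∈ I, edgeProb n σ ^ m *
          ((m + 1) * ∑ u, defectProb σ m (extendByZero y.2) u) ^ 2 := by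
      rw [Finset.sum_product]
      refine Finset.sum_congr rfl fun y _ => ?_
      rw [← Finset.mul_sum]
      exact congrArg _ (hJ (defectProb σ m (extendByZero y.2)))
    _ ≤ ∑ _y ∈ I, edgeProb n σ ^ m *
          ((m + 1) * (m * ((σ : ℝ) / n) + n * edgeProb n σ)) ^ 2 := by
      refine Finset.sum_le_sum fun y _ => ?_
      have h0 : 0 ≤ ∑ u, defectProb σ m (extendByZero (n := n) y.2) u :=
        Finset.sum_nonneg fun u _ => defectProb_nonneg (by omega) (by omega) _ _
      have h1 := sum_defectProb_le (m := m) (by omega : 1 ≤ σ) (by omega) (extendByZero (n := n) y.2)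
      gcongr
    _ = _ := by
      rw [Finset.sum_const, Finset.card_product, nsmul_eq_mul]
      simp only [Finset.card_univ, Fintype.card_fun, Fintype.card_fin]
      push_cast
      ring

/-! ### Bounds for the expected numbers -/

lemma div_sub_one_pow_le {n m : ℕ} (hn : 2 ≤ n) (hm : m + 1 ≤ n) :
    ((n : ℝ) / (n - 1)) ^ m ≤ Real.exp 1 := by
  have h2 : (2 : ℝ) ≤ n := by exact_mod_cast hn
  have hm' : (m : ℝ) + 1 ≤ n := by exact_mod_cast hm
  have hpos : (0 : ℝ) < n - 1 := by linarith
  have h1 : (n : ℝ) / (n - 1) ≤ Real.exp (1 / (n - 1)) := by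
    have := Real.add_one_le_exp (1 / ((n : ℝ) - 1))
    refine le_trans (le_of_eq ?_) this
    field_simp
    ring
  calc ((n : ℝ) / (n - 1)) ^ m ≤ Real.exp (1 / (n - 1)) ^ m := by gcongr
    _ = Real.exp (m * (1 / (n - 1))) := (Real.exp_nat_mul _ _).symm
    _ ≤ _ := by
      rw [Real.exp_le_exp, mul_one_div, div_le_one hpos]
      linarith

/-- Each full block of `d` siblings contributes the factor `λ ^ d / d!`, where
`λ = σ (σ - 1)`. -/
lemma expected_trees_le {n σ d r p : ℕ} (hσ : 2 ≤ σ) (hn : 2 ≤ n) (hr : r ≤ d)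
    (hm : p * d + r + 1 ≤ n) :
    (n : ℝ) ^ (p * d + r + 1) * (sortedEdges n d (p * d + r)).card * edgeProb n σ ^ (p * d + r) ≤
      Real.exp 1 * n * (((σ : ℝ) * (σ - 1)) ^ d / d.factorial) ^ p *
        (((σ : ℝ) * (σ - 1)) ^ r / r.factorial) := by
  have h2 : (2 : ℝ) ≤ n := by exact_mod_cast hn
  have hσ2 : (2 : ℝ) ≤ σ := by exact_mod_cast hσ
  have hl : 0 ≤ (σ : ℝ) * (σ - 1) := mul_nonneg (by linarith) (by linarith)
  have hq := edgeProb_nonneg (n := n) (σ := σ) (by omega) (by omega)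
  have h1 := card_sortedEdges_le n p hr
  have h3 := div_sub_one_pow_le hn hm
  have hn0 : (n : ℝ) ≠ 0 := by linarith
  have hn1 : (n : ℝ) - 1 ≠ 0 := by linarith
  calc _ ≤ (n : ℝ) ^ (p * d + r + 1) *
        ((n : ℝ) ^ (p * d + r) / ((d.factorial : ℝ) ^ p * r.factorial)) *
          edgeProb n σ ^ (p * d + r) := by gcongr
    _ = ((n : ℝ) / (n - 1)) ^ (p * d + r) * (n * (((σ : ℝ) * (σ - 1)) ^ d / d.factorial) ^ p *
        (((σ : ℝ) * (σ - 1)) ^ r / r.factorial)) := by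
      have h4 : edgeProb n σ * n * n = (n : ℝ) / (n - 1) * (σ * (σ - 1)) := by
        rw [edgeProb]; field_simp
      have h5 : edgeProb n σ ^ (p * d + r) * (n : ℝ) ^ (p * d + r) * (n : ℝ) ^ (p * d + r) =
          ((n : ℝ) / (n - 1)) ^ (p * d + r) *
            ((((σ : ℝ) * (σ - 1)) ^ d) ^ p * ((σ : ℝ) * (σ - 1)) ^ r) := by
        rw [← mul_pow, ← mul_pow, h4, mul_pow, pow_add (_ * _) (p * d) r, mul_comm p d, pow_mul]
      rw [div_pow _ (d.factorial : ℝ) p, pow_succ (n : ℝ) (p * d + r)]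
      calc _ = (edgeProb n σ ^ (p * d + r) * (n : ℝ) ^ (p * d + r) * (n : ℝ) ^ (p * d + r)) *
            (n / ((d.factorial : ℝ) ^ p * r.factorial)) := by ring
        _ = _ := by
          rw [h5]
          generalize ((n : ℝ) / (n - 1)) ^ (p * d + r) = x
          field_simp
    _ ≤ Real.exp 1 * (n * (((σ : ℝ) * (σ - 1)) ^ d / d.factorial) ^ p *
        (((σ : ℝ) * (σ - 1)) ^ r / r.factorial)) := by gcongr
    _ = _ := by ring

lemma initialLaw_real_exists_isTree_le {n σ d P : ℕ} (hσ : 2 ≤ σ) (hn : σ ≤ n)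
    (hP : P * d + 1 ≤ n) :
    (initialLaw n σ).real {ω | ∃ f g, IsTree d (P * d) ω f g} ≤
      Real.exp 1 * n * (((σ : ℝ) * (σ - 1)) ^ d / d.factorial) ^ P := by
  have : NeZero n := ⟨by omega⟩
  refine (initialLaw_real_exists_isTree_le_card hσ hn).trans ?_
  simpa using expected_trees_le (r := 0) (d := d) (p := P) hσ (hσ.trans hn) (Nat.zero_le _)
    (by simpa using hP)

/-- A tree with `m` edges has at most `(m + 1) ^ 2` choices for the kind of each of the two
defects, up to a constant, and each of the defects costs a factor `1 / n`. -/
lemma initialLaw_real_exists_isDefectiveTree_le {n σ d m : ℕ} (hσ : 2 ≤ σ) (hn : σ ≤ n)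
    (hd : 0 < d) (hm : m + 1 ≤ n)
    (hq : ((σ : ℝ) * (σ - 1)) ^ d / d.factorial ≤ 1) :
    (initialLaw n σ).real {ω | ∃ f g u₁ u₂ k₁ k₂, IsDefectiveTree d m ω f g u₁ u₂ k₁ k₂} ≤
      4 * Real.exp (1 + σ * (σ - 1)) * ((σ : ℝ) * (σ - 1)) ^ 2 * (m + 1) ^ 4 / n := by
  have : NeZero n := ⟨by omega⟩
  have hσ2 : (2 : ℝ) ≤ σ := by exact_mod_cast hσ
  have hn2 : (2 : ℝ) ≤ n := by exact_mod_cast hσ.trans hn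
  set l : ℝ := (σ : ℝ) * (σ - 1) with hl_def
  have hσl : (σ : ℝ) ≤ l := by rw [hl_def]; nlinarith
  have hl : 0 ≤ l := by linarith
  have hm' : m / d * d + m % d = m := Nat.div_add_mod' m d
  have h1 := expected_trees_le (r := m % d) (p := m / d) hσ (hσ.trans hn) (Nat.mod_lt m hd).le
    (by rw [hm']; exact hm)
  rw [hm', ← hl_def] at h1
  have h2 : (l ^ d / d.factorial) ^ (m / d) ≤ 1 := pow_le_one₀ (by positivity) hq
  have h3 : l ^ (m % d) / ((m % d).factorial : ℝ) ≤ Real.exp l := Real.pow_div_factorial_le_exp l hl _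
  have hE : (m + 1) * (m * ((σ : ℝ) / n) + n * edgeProb n σ) ≤ 2 * l * (m + 1) ^ 2 / n := by
    have h4 : n * edgeProb n σ ≤ 2 * l / n := by
      have h6 : n * edgeProb n σ = l / (n - 1) := by
        have hn1 : (n : ℝ) - 1 ≠ 0 := by linarith
        rw [edgeProb, ← hl_def]; field_simp
      rw [h6, div_le_div_iff₀ (by linarith) (by linarith)]
      nlinarith
    have h5 : m * ((σ : ℝ) / n) ≤ m * (2 * l / n) := by gcongr; linarith
    calc (m + 1) * (m * ((σ : ℝ) / n) + n * edgeProb n σ)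
        ≤ (m + 1) * (m * (2 * l / n) + 2 * l / n) := by gcongr
      _ = _ := by ring
  have hE0 : 0 ≤ (m + 1) * (m * ((σ : ℝ) / n) + n * edgeProb n σ) := by
    have := edgeProb_nonneg (n := n) (σ := σ) (by omega) (by omega)
    positivity
  refine (initialLaw_real_exists_isDefectiveTree_le_card hσ hn).trans ?_
  calc _ ≤ (Real.exp 1 * n * 1 * Real.exp l) * (2 * l * (m + 1) ^ 2 / n) ^ 2 := by
        refine mul_le_mul (h1.trans ?_) (pow_le_pow_left₀ hE0 hE 2) (by positivity) (by positivity)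
        gcongr
    _ = _ := by
      rw [Real.exp_add]
      field_simp
      ring

/-- Near the threshold `d + 2 > e λ`, the factor `√d` in Stirling's formula makes up for the two
missing factors `λ`. -/
lemma pow_lt_factorial {σ d : ℕ} (hσ : 2 ≤ σ)
    (hd : Real.exp 1 * ((σ : ℝ) * (σ - 1)) < d + 2) :
    ((σ : ℝ) * (σ - 1)) ^ d < d.factorial := by
  have he := Real.exp_one_gt_d9
  rcases hσ.eq_or_lt with rfl | hσ3
  · have hd4 : 4 ≤ d := by
      have : (3 : ℝ) < d := by push_cast at hd; linarith
      exact_mod_cast this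
    have : 2 ^ d < d.factorial := by
      clear hd
      induction d, hd4 using Nat.le_induction with
      | base => decide
      | succ k hk ih =>
        rw [pow_succ, Nat.factorial_succ]; nlinarith
    norm_num
    exact_mod_cast this
  · have hσ3' : (3 : ℝ) ≤ σ := by exact_mod_cast hσ3
    set l : ℝ := (σ : ℝ) * (σ - 1) with hl_def
    have hl : 6 ≤ l := by rw [hl_def]; nlinarith
    have hd14 : (14 : ℝ) < d := by nlinarith
    have hd0 : (0 : ℝ) < d := by linarith
    have hle : l < (d + 2) / Real.exp 1 := by
      rw [lt_div_iff₀ (Real.exp_pos 1)]; linarith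
    have hd' : d ≠ 0 := by rintro rfl; simp at hd0
    have h1 : ((d + 2 : ℝ) / d) ^ d ≤ Real.exp 2 := by
      have h2 : (d + 2 : ℝ) / d ≤ Real.exp (2 / d) := by
        refine le_trans (le_of_eq ?_) (Real.add_one_le_exp (2 / (d : ℝ)))
        field_simp; ring
      calc ((d + 2 : ℝ) / d) ^ d ≤ Real.exp (2 / d) ^ d := by gcongr
        _ = Real.exp 2 := by rw [← Real.exp_nat_mul]; congr 1; field_simp
    have h3 : Real.exp 2 ≤ √(2 * Real.pi * d) := by
      apply Real.le_sqrt_of_sq_le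
      have h4 : Real.exp 2 ^ 2 = Real.exp 1 ^ 4 := by
        rw [← Real.exp_nat_mul, ← Real.exp_nat_mul]; norm_num
      have h5 : Real.exp 1 ^ 4 ≤ 2.72 ^ 4 := by
        gcongr; linarith [Real.exp_one_lt_d9]
      have h6 := Real.pi_gt_three
      rw [h4]; nlinarith
    calc l ^ d < ((d + 2) / Real.exp 1) ^ d := by gcongr
      _ = ((d + 2 : ℝ) / d) ^ d * (d / Real.exp 1) ^ d := by
        rw [← mul_pow]; congr 1; field_simp
      _ ≤ √(2 * Real.pi * d) * (d / Real.exp 1) ^ d := by gcongr; exact h1.trans h3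
      _ ≤ _ := Stirling.le_factorial_stirling d

/-- For fixed `σ`, the factors `λ ^ d / d!` stay away from `1` in the whole range
`d + 2 > e λ`. -/
lemma exists_pow_div_factorial_le (σ : ℕ) (hσ : 2 ≤ σ) :
    ∃ q : ℝ, 0 < q ∧ q < 1 ∧ ∀ d : ℕ, Real.exp 1 * ((σ : ℝ) * (σ - 1)) < d + 2 →
      ((σ : ℝ) * (σ - 1)) ^ d / d.factorial ≤ q := by
  have hσ2 : (2 : ℝ) ≤ σ := by exact_mod_cast hσ
  have he := Real.exp_one_gt_d9
  set l : ℝ := (σ : ℝ) * (σ - 1) with hl_def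
  have hl : 2 ≤ l := by rw [hl_def]; nlinarith
  have hex : ∃ d : ℕ, Real.exp 1 * l < d + 2 := by
    obtain ⟨d, hd⟩ := exists_nat_gt (Real.exp 1 * l)
    exact ⟨d, by linarith⟩
  classical
  refine ⟨l ^ (Nat.find hex) / (Nat.find hex).factorial, by positivity, ?_, fun d hd => ?_⟩
  · rw [div_lt_one (by positivity)]
    exact pow_lt_factorial hσ (Nat.find_spec hex)
  · have hle : Nat.find hex ≤ d := Nat.find_min' hex hd
    induction d, hle using Nat.le_induction with
    | base => exact le_rfl
    | succ k hk ih =>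
      have hk0 : Real.exp 1 * l < k + 2 :=
        (Nat.find_spec hex).trans_le (by gcongr)
      refine le_trans ?_ (ih hk0)
      rw [pow_succ, Nat.factorial_succ, Nat.cast_mul, mul_comm ((k + 1 : ℕ) : ℝ), ← div_mul_div_comm]
      refine mul_le_of_le_one_right (by positivity) ?_
      rw [div_le_one (by positivity)]
      push_cast
      nlinarith

/-! ### Two or more choices -/

lemma minmaxBitrate_eq_one_of_no_tree {n σ d κ h P : ℕ} (hσ : 2 ≤ σ) (hn : 1 ≤ n) (hd : 0 < d)
    (hdκ : d + 1 ≤ κ) (hP : ∀ i < P, depth d i < h) {ω : State n} (hω : ∀ u, (ω u).card = σ)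
    (hT : ¬ ∃ f g, IsTree d (P * d) ω f g)
    (hD : ∀ m < P * d, ¬ ∃ f g u₁ u₂ k₁ k₂, IsDefectiveTree d m ω f g u₁ u₂ k₁ k₂)
    {S : ℕ → State n} (hS : IsExecution κ ω S) {t : ℕ} (ht : h ≤ t) :
    minmaxBitrate κ (S t) = 1 := by
  have : NeZero n := ⟨by omega⟩
  refine minmaxBitrate_eq_one
    (hS.nonempty (fun u => Finset.card_pos.mp (by rw [hω u]; omega)) t) fun v => ?_
  by_contra hv
  have hvh : κ < load (S h) v := (not_le.mp hv).trans_le (hS.load_antitone v ht)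
  rcases exists_defect_or_tree (A := fun t => {v | κ < load (S t) v}) (fun u => (hω u).symm ▸ hσ)
    (fun t v hv => by
      obtain ⟨U, hU, hU'⟩ := hS.exists_users_of_overloaded hv
      exact ⟨U, by omega, hU'⟩) hd hP hvh with ⟨m, hm, h1⟩ | h1
  · exact hD m hm h1
  · exact hT h1

/-- The union bound over the witness tree with `P * d` edges and the smaller defective trees. -/
lemma initialLaw_real_ge {n σ d κ h P : ℕ} (hσ : 2 ≤ σ) (hn : σ ≤ n) (hd : 0 < d)
    (hdκ : d + 1 ≤ κ) (hP : ∀ i < P, depth d i < h) (hPd : P * d + 1 ≤ n)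
    (hq : ((σ : ℝ) * (σ - 1)) ^ d / d.factorial ≤ 1) :
    1 - (Real.exp 1 * n * (((σ : ℝ) * (σ - 1)) ^ d / d.factorial) ^ P +
        4 * Real.exp (1 + σ * (σ - 1)) * ((σ : ℝ) * (σ - 1)) ^ 2 * (P * d + 1) ^ 5 / n) ≤
      (initialLaw n σ).real {ω | ∀ S : ℕ → State n, IsExecution κ ω S →
        ∀ t, h ≤ t → minmaxBitrate κ (S t) = 1} := by
  have := isProbabilityMeasure_initialLaw hn
  set G := {ω | ∀ S : ℕ → State n, IsExecution κ ω S → ∀ t, h ≤ t → minmaxBitrate κ (S t) = 1}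
  set K : ℝ := 4 * Real.exp (1 + σ * (σ - 1)) * ((σ : ℝ) * (σ - 1)) ^ 2 with hK
  have hK0 : 0 ≤ K := by positivity
  let D : ℕ → Set (State n) := fun m =>
    {ω | ∃ f g u₁ u₂ k₁ k₂, IsDefectiveTree d m ω f g u₁ u₂ k₁ k₂}
  have hcover : Set.univ ⊆ (G ∪ {ω | ∀ u, (ω u).card = σ}ᶜ) ∪
      ({ω | ∃ f g, IsTree d (P * d) ω f g} ∪ ⋃ m ∈ Finset.range (P * d), D m) := by
    intro ω _
    by_contra hω
    simp only [Set.mem_union, not_or, Set.mem_iUnion, not_exists, Finset.mem_range] at hω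
    obtain ⟨⟨hG, hc⟩, hT, hD⟩ := hω
    have hc : ∀ u, (ω u).card = σ := not_not.mp hc
    exact hG fun S hS t ht => minmaxBitrate_eq_one_of_no_tree hσ (by omega) hd hdκ hP hc
      (fun h1 => hT h1) (fun m hm h1 => hD m hm h1) hS ht
  have h1 : (1 : ℝ) ≤ (initialLaw n σ).real G + 0 +
      ((initialLaw n σ).real {ω | ∃ f g, IsTree d (P * d) ω f g} +
        ∑ m ∈ Finset.range (P * d), (initialLaw n σ).real (D m)) := by
    rw [← initialLaw_real_card_ne n σ, ← probReal_univ (μ := initialLaw n σ)]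
    refine (measureReal_mono hcover).trans ((measureReal_union_le _ _).trans ?_)
    exact add_le_add (measureReal_union_le _ _) ((measureReal_union_le _ _).trans
      (add_le_add_right (measureReal_biUnion_finset_le _ _) _))
  have h2 : ∑ m ∈ Finset.range (P * d), (initialLaw n σ).real (D m) ≤
      K * (P * d + 1) ^ 5 / n := by
    calc ∑ m ∈ Finset.range (P * d), (initialLaw n σ).real (D m)
        ≤ ∑ m ∈ Finset.range (P * d), K * ((P * d : ℕ) + 1) ^ 4 / n := by
          refine Finset.sum_le_sum fun m hm => ?_
          have hm : m < P * d := Finset.mem_range.mp hm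
          refine (initialLaw_real_exists_isDefectiveTree_le hσ hn hd (by omega) hq).trans ?_
          rw [← hK]
          gcongr
      _ = (P * d : ℕ) * (K * ((P * d : ℕ) + 1) ^ 4 / n) := by
          rw [Finset.sum_const, Finset.card_range, nsmul_eq_mul]
      _ ≤ ((P * d : ℕ) + 1) * (K * ((P * d : ℕ) + 1) ^ 4 / n) := by gcongr; linarith
      _ = _ := by push_cast; ring
  have h3 := initialLaw_real_exists_isTree_le (d := d) (P := P) hσ hn hPd
  linarith

/-- With `L = log n` and `d + 2 = κ + 1`, the first `P ≤ L ^ 2` nodes of a heap have depth less than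
`8 log log n / log (κ + 1)`. The constant summand is absorbed because `d` is at most `L + 1`. -/
lemma natLog_add_two_le {d P : ℕ} {L : ℝ} (hd : 4 ≤ d) (hL : 4 ≤ L) (hdL : (d : ℝ) ≤ L + 1)
    (hP : (P : ℝ) ≤ L ^ 2) :
    ((Nat.log d P + 2 : ℕ) : ℝ) ≤ 8 * (Real.log L / Real.log (d + 2)) := by
  have hd4 : (4 : ℝ) ≤ d := by exact_mod_cast hd
  have hlogd : 0 < Real.log d := Real.log_pos (by linarith)
  have hlogd2 : 0 < Real.log (d + 2) := Real.log_pos (by linarith)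
  have hLL : 0 < Real.log L := Real.log_pos (by linarith)
  have h1 : Real.log (d + 2) ≤ 2 * Real.log d := by
    have := Real.log_le_log (by linarith) (by nlinarith : (d : ℝ) + 2 ≤ (d : ℝ) ^ 2)
    rwa [Real.log_pow, Nat.cast_ofNat] at this
  have h2 : Real.log (d + 2) ≤ 2 * Real.log L := by
    have := Real.log_le_log (by linarith) (by nlinarith : (d : ℝ) + 2 ≤ L ^ 2)
    rwa [Real.log_pow, Nat.cast_ofNat] at this
  have h3 : (Nat.log d P : ℝ) * Real.log d ≤ 2 * Real.log L := by
    rcases Nat.eq_zero_or_pos P with rfl | hP0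
    · simp; positivity
    · have h4 : ((d ^ Nat.log d P : ℕ) : ℝ) ≤ L ^ 2 :=
        le_trans (by exact_mod_cast Nat.pow_log_le_self d hP0.ne') hP
      rw [Nat.cast_pow] at h4
      have h5 := Real.log_le_log (by positivity) h4
      rwa [Real.log_pow, Real.log_pow, Nat.cast_ofNat] at h5
  rw [← mul_div_assoc, le_div_iff₀ hlogd2]
  push_cast
  have h6 : (Nat.log d P : ℝ) * Real.log (d + 2) ≤ (Nat.log d P : ℝ) * (2 * Real.log d) := by gcongr
  nlinarith

lemma pow_div_factorial_ceil_le {l L : ℝ} (hl : 0 ≤ l) (hL : l * Real.exp 3 ≤ L) :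
    l ^ ⌈L⌉₊ / (⌈L⌉₊.factorial : ℝ) ≤ Real.exp (-2 * L) := by
  -- `x ^ d / d! ≤ e ^ x` at `x = l e ^ 3`
  have h1 := Real.pow_div_factorial_le_exp (l * Real.exp 3) (by positivity) ⌈L⌉₊
  have h2 : Real.exp (3 * L) ≤ Real.exp 3 ^ ⌈L⌉₊ := by
    rw [← Real.exp_nat_mul, Real.exp_le_exp]
    have := Nat.le_ceil L
    linarith
  have h3 : l ^ ⌈L⌉₊ / (⌈L⌉₊.factorial : ℝ) * Real.exp (3 * L) ≤ Real.exp L := by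
    calc _ ≤ l ^ ⌈L⌉₊ / (⌈L⌉₊.factorial : ℝ) * Real.exp 3 ^ ⌈L⌉₊ := by gcongr
      _ = (l * Real.exp 3) ^ ⌈L⌉₊ / (⌈L⌉₊.factorial : ℝ) := by rw [mul_pow]; ring
      _ ≤ _ := h1
      _ ≤ _ := Real.exp_le_exp.mpr hL
  rw [← le_div_iff₀ (Real.exp_pos _), ← Real.exp_sub] at h3
  exact h3.trans_eq (by congr 1; ring)

lemma add_mul_pow_le_sqrt {K L n : ℝ} (hK0 : 0 ≤ K) (hL1 : 1 ≤ L) (hL : Real.exp 1 + K ≤ L)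
    (hL32 : L ^ 32 ≤ n) : Real.exp 1 + K * L ^ 15 ≤ n ^ (1 / 2 : ℝ) := by
  rw [← Real.sqrt_eq_rpow]
  apply Real.le_sqrt_of_sq_le
  have h5 : (1 : ℝ) ≤ L ^ 15 := one_le_pow₀ hL1
  calc (Real.exp 1 + K * L ^ 15) ^ 2 ≤ (L * L ^ 15) ^ 2 := by
        gcongr
        calc Real.exp 1 + K * L ^ 15 ≤ Real.exp 1 * L ^ 15 + K * L ^ 15 := by
              gcongr; exact le_mul_of_one_le_right (Real.exp_pos 1).le h5
          _ = (Real.exp 1 + K) * L ^ 15 := by ring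
          _ ≤ _ := by gcongr
    _ = L ^ 32 := by ring
    _ ≤ n := hL32

set_option maxHeartbeats 400000 in
/-- With two or more choices, all users are satisfied after `O(log log n / log (κ + 1))` steps. -/
theorem minmaxBitrate_eq_one_whp (σ : ℕ) (hσ : 2 ≤ σ) :
    ∃ C > (0 : ℝ), ∃ c > (0 : ℝ), ∃ n₀ : ℕ, ∀ n ≥ n₀, ∀ κ : ℕ,
      Real.exp 1 * ((σ : ℝ) * ((σ : ℝ) - 1)) < (κ : ℝ) + 1 →
        1 - (n : ℝ) ^ (-c) ≤ (initialLaw n σ).real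
          {ω | ∀ S : ℕ → State n, IsExecution κ ω S →
            ∀ t : ℕ, C * (Real.log (Real.log (n : ℝ)) / Real.log ((κ : ℝ) + 1)) ≤ (t : ℝ) →
              minmaxBitrate κ (S t) = 1} := by
  obtain ⟨q, hq0, hq1, hq⟩ := exists_pow_div_factorial_le σ hσ
  have hσ2 : (2 : ℝ) ≤ σ := by exact_mod_cast hσ
  set l : ℝ := (σ : ℝ) * (σ - 1) with hl_def
  have hl : 2 ≤ l := by rw [hl_def]; nlinarith
  set K : ℝ := 4 * Real.exp (1 + l) * l ^ 2 with hK
  have hK0 : 0 ≤ K := by positivity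
  -- `P = ⌈A log n⌉` nodes make `q ^ P` at most `n ^ (-2)`
  set A : ℝ := 2 / (-Real.log q) with hA
  have hlogq : 0 < -Real.log q := by linarith [Real.log_neg hq0 hq1]
  have hA0 : 0 < A := by positivity
  have hlog : Tendsto (fun n : ℕ => Real.log (n : ℝ)) atTop atTop :=
    Real.tendsto_log_atTop.comp tendsto_natCast_atTop_atTop
  have hev1 := hlog.eventually_ge_atTop (2 * A + Real.exp 1 + K + l * Real.exp 3 + 8)
  have hev2 : ∀ᶠ n : ℕ in atTop, Real.log (n : ℝ) ^ 32 ≤ n := by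
    have h := (Real.isLittleO_pow_log_id_atTop (n := 32)).comp_tendsto
      (tendsto_natCast_atTop_atTop (R := ℝ))
    filter_upwards [h.bound one_pos, hlog.eventually_ge_atTop 0] with n hn hn0
    simpa [abs_of_nonneg hn0] using hn
  obtain ⟨n₀, hn₀⟩ := eventually_atTop.mp (hev1.and (hev2.and (eventually_ge_atTop (max σ 2))))
  refine ⟨8, by norm_num, 1 / 2, by norm_num, n₀, fun n hn κ hκ => ?_⟩
  obtain ⟨hL, hL32, hnσ2⟩ := hn₀ n hn
  set L : ℝ := Real.log n with hL_def
  have hnσ : σ ≤ n := (le_max_left _ _).trans hnσ2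
  have hn2 : (2 : ℝ) ≤ n := by exact_mod_cast (le_max_right _ _).trans hnσ2
  have hn0 : (0 : ℝ) < n := by linarith
  have hle3 : 0 ≤ l * Real.exp 3 := by positivity
  have he : 0 < Real.exp 1 := Real.exp_pos 1
  have hL8 : 8 ≤ L := by linarith
  have hLL : 0 < Real.log L := Real.log_pos (by linarith)
  have := isProbabilityMeasure_initialLaw hnσ
  -- the common end of both cases
  have finish : ∀ d P h : ℕ, 0 < d → d + 1 ≤ κ → (∀ i < P, depth d i < h) →
      ((P : ℝ) * d + 1 ≤ L ^ 3) → l ^ d / d.factorial ≤ 1 →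
      (l ^ d / d.factorial) ^ P ≤ (n : ℝ) ^ (-2 : ℝ) →
      (∀ t : ℕ, 8 * (Real.log L / Real.log ((κ : ℝ) + 1)) ≤ (t : ℝ) → h ≤ t) →
      1 - (n : ℝ) ^ (-(1 / 2) : ℝ) ≤ (initialLaw n σ).real
          {ω | ∀ S : ℕ → State n, IsExecution κ ω S →
            ∀ t : ℕ, 8 * (Real.log L / Real.log ((κ : ℝ) + 1)) ≤ (t : ℝ) →
              minmaxBitrate κ (S t) = 1} := by
    intro d P h hd hdκ hP hPd hq1 hqP ht
    have hL3 : L ^ 3 ≤ n := (pow_le_pow_right₀ (by linarith) (by norm_num)).trans hL32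
    have hPd' : P * d + 1 ≤ n := by exact_mod_cast hPd.trans hL3
    have h1 := initialLaw_real_ge hσ hnσ hd hdκ hP hPd' hq1
    rw [← hl_def, ← hK] at h1
    refine le_trans ?_ (h1.trans (measureReal_mono fun ω hω S hS t htt => hω S hS t (ht t htt)))
    have h2 : Real.exp 1 * n * (l ^ d / d.factorial) ^ P ≤ Real.exp 1 / n := by
      calc _ ≤ Real.exp 1 * n * (n : ℝ) ^ (-2 : ℝ) := by gcongr
        _ = Real.exp 1 / n := by
          rw [Real.rpow_neg hn0.le, Real.rpow_two]; field_simp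
    have h3 : K * (P * d + 1) ^ 5 / n ≤ K * L ^ 15 / n := by
      have : ((P : ℝ) * d + 1) ^ 5 ≤ (L ^ 3) ^ 5 := by gcongr
      rw [← pow_mul] at this
      gcongr
    have h4 := add_mul_pow_le_sqrt hK0 (by linarith) (by linarith) hL32
    have h6 : (Real.exp 1 + K * L ^ 15) / n ≤ (n : ℝ) ^ (-(1 / 2) : ℝ) := by
      rw [div_le_iff₀ hn0]
      calc _ ≤ _ := h4
        _ = (n : ℝ) ^ (-(1 / 2) : ℝ) * (n : ℝ) ^ (1 : ℝ) := by
          rw [← Real.rpow_add hn0]; norm_num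
        _ = _ := by rw [Real.rpow_one]
    rw [add_div] at h6
    linarith
  have hκ5 : 5 ≤ κ := by
    have h1 := Real.exp_one_gt_d9
    have : (4 : ℝ) < κ := by nlinarith
    exact_mod_cast this
  have hκ1 : ((κ - 1 : ℕ) : ℝ) = κ - 1 := by rw [Nat.cast_sub (by omega)]; simp
  rcases le_or_gt (κ - 1) ⌈L⌉₊ with hκL | hκL
  · have hceil : (⌈L⌉₊ : ℝ) < L + 1 := Nat.ceil_lt_add_one (by linarith)
    have hκL' : ((κ - 1 : ℕ) : ℝ) ≤ L + 1 :=
      le_trans (by exact_mod_cast hκL) hceil.le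
    have hd := hq (κ - 1) (by rw [hκ1]; linarith)
    have hPceil : (⌈A * L⌉₊ : ℝ) < A * L + 1 := Nat.ceil_lt_add_one (by positivity)
    have hA1 : A * L + 1 ≤ (A + 1) * L := by nlinarith
    refine finish (κ - 1) ⌈A * L⌉₊ (Nat.log (κ - 1) ⌈A * L⌉₊ + 2) (by omega) (by omega)
      (fun i hi => ?_) ?_ (hd.trans hq1.le) ?_ fun t ht => ?_
    · have h1 := depth_le (κ - 1) (by omega) i
      have h2 : Nat.log (κ - 1) i ≤ Nat.log (κ - 1) ⌈A * L⌉₊ := Nat.log_mono_right hi.le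
      omega
    · calc (⌈A * L⌉₊ : ℝ) * (κ - 1 : ℕ) + 1 ≤ (A + 1) * L * (2 * L) + L * L := by
            have h1 : ((κ - 1 : ℕ) : ℝ) ≤ 2 * L := by linarith
            have h2 : (⌈A * L⌉₊ : ℝ) ≤ (A + 1) * L := by linarith
            have h3 : (1 : ℝ) ≤ L * L := by nlinarith
            gcongr
        _ = (2 * A + 3) * L ^ 2 := by ring
        _ ≤ L * L ^ 2 := by gcongr; linarith
        _ = L ^ 3 := by ring
    · calc (l ^ (κ - 1) / ((κ - 1).factorial : ℝ)) ^ ⌈A * L⌉₊ ≤ q ^ ⌈A * L⌉₊ := by gcongr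
        _ = Real.exp (⌈A * L⌉₊ * Real.log q) := by
          rw [Real.exp_nat_mul, Real.exp_log hq0]
        _ ≤ Real.exp (L * (-2)) := by
          rw [Real.exp_le_exp]
          have h1 : A * L * (-Real.log q) = 2 * L := by
            rw [mul_right_comm, hA, div_mul_cancel₀ _ hlogq.ne']
          have h2 : A * L * (-Real.log q) ≤ ⌈A * L⌉₊ * (-Real.log q) := by
            gcongr; exact Nat.le_ceil _
          linarith
        _ = _ := by rw [Real.rpow_def_of_pos hn0]
    · have h1 := natLog_add_two_le (d := κ - 1) (P := ⌈A * L⌉₊) (L := L) (by omega) (by linarith) hκL'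
        (by nlinarith)
      have h2 : ((κ - 1 : ℕ) : ℝ) + 2 = κ + 1 := by rw [hκ1]; ring
      rw [h2] at h1
      exact_mod_cast h1.trans ht
  · have hceil : (⌈L⌉₊ : ℝ) < L + 1 := Nat.ceil_lt_add_one (by linarith)
    have hd0 : 0 < ⌈L⌉₊ := Nat.ceil_pos.mpr (by linarith)
    have hsmall := pow_div_factorial_ceil_le (l := l) (L := L) (by linarith) (by linarith)
    rw [mul_comm, ← Real.rpow_def_of_pos hn0] at hsmall
    refine finish ⌈L⌉₊ 1 1 hd0 (by omega) (fun i hi => ?_) ?_ (hsmall.trans ?_)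
      (by rwa [pow_one]) fun t ht => ?_
    · obtain rfl : i = 0 := by omega
      simp [depth]
    · have h1 : 2 ≤ L * L := by nlinarith
      push_cast
      nlinarith
    · exact Real.rpow_le_one_of_one_le_of_nonpos (by linarith) (by norm_num)
    · have hκ0 : 0 < Real.log ((κ : ℝ) + 1) := by
        have : (5 : ℝ) ≤ κ := by exact_mod_cast hκ5
        exact Real.log_pos (by linarith)
      have : (0 : ℝ) < t := lt_of_lt_of_le (by positivity) ht
      exact_mod_cast this

/-! ### One choice: the maximal load -/

/-- The coefficient inequality behind Poissonization: the maps from `α` to `N` bins with fewer than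
`k` elements in each bin have `(∑ j < k, x ^ j / j!) ^ N` as exponential generating function in
`|α|`, which is compared with its value at `x = 1`. -/
lemma card_fibres_lt_le (k N : ℕ) (α : Type) [Fintype α] [DecidableEq α] :
    ((Finset.univ.filter fun x : α → Fin N =>
        ∀ s, (Finset.univ.filter fun u => x u = s).card < k).card : ℝ) ≤
      (Fintype.card α).factorial * (∑ j ∈ Finset.range k, 1 / (j.factorial : ℝ)) ^ N := by
  set a : ℝ := ∑ j ∈ Finset.range k, 1 / (j.factorial : ℝ)
  have ha : 0 ≤ a := Finset.sum_nonneg fun j _ => by positivity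
  induction N generalizing α with
  | zero =>
    have h1 : (Finset.univ.filter fun x : α → Fin 0 =>
        ∀ s, (Finset.univ.filter fun u => x u = s).card < k).card ≤ 1 :=
      Finset.card_le_one_of_subsingleton _
    have h2 : (1 : ℝ) ≤ (Fintype.card α).factorial := by
      exact_mod_cast Nat.factorial_pos _
    rw [pow_zero, mul_one]
    exact le_trans (by exact_mod_cast h1) h2
  | succ N ih =>
    set F := Finset.univ.filter fun x : α → Fin (N + 1) =>
        ∀ s, (Finset.univ.filter fun u => x u = s).card < k with hF
    -- split according to the fibre over the last bin
    have hfib : ∀ A : Finset α,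
        ((F.filter fun x => (Finset.univ.filter fun u => x u = Fin.last N) = A).card : ℝ) ≤
          if A.card < k then ((Fintype.card α - A.card).factorial : ℝ) * a ^ N else 0 := by
      intro A
      split_ifs with hA
      · refine le_trans ?_ ((ih {u // u ∉ A}).trans_eq ?_)
        · have hsub : (F.filter fun x => (Finset.univ.filter fun u => x u = Fin.last N) = A) ⊆
              (Finset.univ.filter fun x : {u // u ∉ A} → Fin N =>
                ∀ s, (Finset.univ.filter fun u => x u = s).card < k).image
              fun x u => if h : u ∈ A then Fin.last N else (x ⟨u, h⟩).castSucc := by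
            intro x hx
            simp only [hF, Finset.mem_filter, Finset.mem_univ, true_and] at hx
            obtain ⟨hx, hxA⟩ := hx
            have hmem : ∀ u, u ∈ A ↔ x u = Fin.last N := fun u => by rw [← hxA]; simp
            refine Finset.mem_image.mpr ⟨fun u => (x u).castPred
              fun h => u.2 ((hmem u).mpr h), ?_, ?_⟩
            · simp only [Finset.mem_filter, Finset.mem_univ, true_and]
              refine fun s => lt_of_le_of_lt ?_ (hx s.castSucc)
              refine Finset.card_le_card_of_injOn Subtype.val (fun u hu => ?_)
                Subtype.val_injective.injOn
              simp only [Finset.coe_filter, Finset.mem_univ, true_and, Set.mem_ofPred_eq] at hu ⊢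
              rw [← hu, Fin.castSucc_castPred]
            · funext u
              split_ifs with h
              · exact ((hmem u).mp h).symm
              · rw [Fin.castSucc_castPred]
          exact_mod_cast (Finset.card_le_card hsub).trans Finset.card_image_le
        · rw [Fintype.card_subtype_compl, Fintype.card_coe]
      · have : (F.filter fun x => (Finset.univ.filter fun u => x u = Fin.last N) = A) = ∅ := by
          refine Finset.filter_eq_empty_iff.mpr fun x hx hxA => hA ?_
          rw [← hxA]
          exact (Finset.mem_filter.mp hx).2 _
        rw [this]; simp
    have hsum : F.card = ∑ A ∈ (Finset.univ : Finset α).powerset,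
        (F.filter fun x => (Finset.univ.filter fun u => x u = Fin.last N) = A).card :=
      Finset.card_eq_sum_card_fiberwise fun x _ => by simp
    rw [hsum, Nat.cast_sum]
    calc _ ≤ ∑ A ∈ (Finset.univ : Finset α).powerset,
          (if A.card < k then ((Fintype.card α - A.card).factorial : ℝ) * a ^ N else 0) :=
        Finset.sum_le_sum fun A _ => hfib A
      _ = ∑ j ∈ Finset.range (Fintype.card α + 1), (Fintype.card α).choose j •
          (if j < k then ((Fintype.card α - j).factorial : ℝ) * a ^ N else 0) := by
        rw [Finset.sum_powerset_apply_card
          (fun j => if j < k then ((Fintype.card α - j).factorial : ℝ) * a ^ N else 0),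
          Finset.card_univ]
      _ = ∑ j ∈ Finset.range (Fintype.card α + 1), if j < k then
          ((Fintype.card α).factorial : ℝ) * a ^ N * (1 / j.factorial) else 0 := by
        refine Finset.sum_congr rfl fun j hj => ?_
        have hj : j ≤ Fintype.card α := Nat.lt_succ_iff.mp (Finset.mem_range.mp hj)
        split_ifs
        · have h1 : ((Fintype.card α).choose j : ℝ) * j.factorial *
              (Fintype.card α - j).factorial = (Fintype.card α).factorial := by
            exact_mod_cast Nat.choose_mul_factorial_mul_factorial hj
          rw [← h1, nsmul_eq_mul]
          field_simp
        · simp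
      _ ≤ ∑ j ∈ Finset.range k,
          ((Fintype.card α).factorial : ℝ) * a ^ N * (1 / j.factorial) := by
        rw [← Finset.sum_filter]
        refine Finset.sum_le_sum_of_subset_of_nonneg (fun j hj => ?_) fun j _ _ => by positivity
        exact Finset.mem_range.mpr (Finset.mem_filter.mp hj).2
      _ = _ := by rw [← Finset.mul_sum, pow_succ]; ring

lemma initialLaw_one_real_load_lt_le {n : ℕ} (hn : 1 ≤ n) (k : ℕ) :
    (initialLaw n 1).real {ω | ∀ s, load ω s < k} ≤
      n.factorial * (∑ j ∈ Finset.range k, 1 / (j.factorial : ℝ)) ^ n / (n : ℝ) ^ n := by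
  classical
  have h : initialLaw n 1 = uniformOn ((Fintype.piFinset fun _ : Fin n =>
      Finset.powersetCard 1 (Finset.univ : Finset (Fin n)) : Finset (State n)) : Set (State n)) := by
    rw [initialLaw, Fintype.coe_piFinset, ← setOf_card_eq]
    exact uniformOn_pi.symm
  have hset : {ω : State n | ∀ s, load ω s < k} =
      ((Finset.univ.filter fun ω => ∀ s, load ω s < k : Finset (State n)) : Set _) := by
    ext; simp
  rw [measureReal_def, h, hset, uniformOn_apply_finset, ENNReal.toReal_div, ENNReal.toReal_natCast,
    ENNReal.toReal_natCast, Fintype.card_piFinset]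
  simp only [Finset.card_powersetCard, Finset.card_univ, Fintype.card_fin, Nat.choose_one_right,
    Finset.prod_const, Nat.cast_pow]
  gcongr
  have hcount := card_fibres_lt_le k n (Fin n)
  rw [Fintype.card_fin] at hcount
  refine le_trans ?_ hcount
  norm_cast
  refine (Finset.card_le_card fun ω hω => ?_).trans
    (Finset.card_image_le (f := fun (x : Fin n → Fin n) (u : Fin n) => ({x u} : Finset (Fin n))))
  simp only [Finset.mem_inter, Fintype.mem_piFinset, Finset.mem_powersetCard, Finset.subset_univ,
    true_and, Finset.mem_filter, Finset.mem_univ, Finset.card_eq_one] at hω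
  obtain ⟨h1, h2⟩ := hω
  choose x hx using h1
  refine Finset.mem_image.mpr ⟨x, ?_, funext fun u => (hx u).symm⟩
  simp only [Finset.mem_filter, Finset.mem_univ, true_and]
  intro s
  convert h2 s using 1
  rw [load]
  congr 1
  ext u
  simp [hx, eq_comm]

lemma factorial_le_sqrt_mul (n : ℕ) (hn : 1 ≤ n) :
    (n.factorial : ℝ) ≤ Real.exp 1 * √n * (n / Real.exp 1) ^ n := by
  obtain ⟨m, rfl⟩ : ∃ m, n = m + 1 := ⟨n - 1, by omega⟩
  have h := Stirling.stirlingSeq'_antitone (Nat.zero_le m)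
  simp only [Function.comp, Nat.succ_eq_add_one, zero_add, Stirling.stirlingSeq_one] at h
  rw [Stirling.stirlingSeq, div_le_iff₀ (by positivity)] at h
  refine h.trans_eq ?_
  rw [Real.sqrt_mul (by norm_num)]
  field_simp

/-- With one choice, no server has load `k` with a probability that is tiny as soon as `k!` is
small compared to `n`. -/
lemma initialLaw_one_real_load_lt_le_exp {n : ℕ} (hn : 1 ≤ n) (k : ℕ) :
    (initialLaw n 1).real {ω | ∀ s, load ω s < k} ≤
      Real.exp 1 * √n * Real.exp (-(n / (Real.exp 1 * k.factorial))) := by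
  have hn0 : (0 : ℝ) < n := by exact_mod_cast hn
  have he := Real.exp_pos 1
  set a : ℝ := ∑ j ∈ Finset.range k, 1 / (j.factorial : ℝ) with ha
  have ha0 : 0 ≤ a := Finset.sum_nonneg fun j _ => by positivity
  have ha1 : a + 1 / k.factorial ≤ Real.exp 1 := by
    have := Real.sum_le_exp_of_nonneg (zero_le_one : (0 : ℝ) ≤ 1) (k + 1)
    simpa [Finset.sum_range_succ, ha] using this
  have ha2 : a / Real.exp 1 ≤ Real.exp (-(1 / (Real.exp 1 * k.factorial))) := by
    refine le_trans ?_ (Real.one_sub_le_exp_neg _)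
    rw [div_le_iff₀ he, sub_mul]
    have : 1 / (Real.exp 1 * k.factorial) * Real.exp 1 = 1 / k.factorial := by field_simp
    linarith
  calc _ ≤ _ := initialLaw_one_real_load_lt_le hn k
    _ ≤ Real.exp 1 * √n * (n / Real.exp 1) ^ n * a ^ n / (n : ℝ) ^ n := by
      gcongr
      exact factorial_le_sqrt_mul n hn
    _ = Real.exp 1 * √n * (a / Real.exp 1) ^ n := by
      rw [div_pow, div_pow]; field_simp
    _ ≤ Real.exp 1 * √n * Real.exp (-(1 / (Real.exp 1 * k.factorial))) ^ n := by gcongr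
    _ = _ := by
      rw [← Real.exp_nat_mul]
      congr 2
      ring

lemma IsExecution.eq_initial_of_card_eq_one {n κ : ℕ} {ω : State n} {S : ℕ → State n}
    (h : IsExecution κ ω S) (hω : ∀ u, (ω u).card = 1) (t : ℕ) : S t = ω := by
  induction t with
  | zero => exact h.1
  | succ t ih =>
    funext u
    rcases h.2 t u with ⟨s, hs, -, hS⟩ | ⟨-, hS⟩
    · rw [ih] at hs
      obtain ⟨s', hs'⟩ := Finset.card_eq_one.mp (hω u)
      rw [hs', Finset.mem_singleton] at hs
      rw [hS, hs', hs]
    · rw [hS, ih]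

lemma minmaxBitrate_le_div_load {n κ : ℕ} {ω : State n} (hω : ∀ u, (ω u).card = 1) {s : Fin n}
    (hs : 0 < load ω s) : minmaxBitrate κ ω ≤ κ / load ω s := by
  obtain ⟨u, hu⟩ := Finset.card_pos.mp hs
  have hu : s ∈ ω u := by simpa using hu
  have : Nonempty (Fin n) := ⟨s⟩
  refine (ciInf_le (Set.finite_range _).bddBelow u).trans (ciSup_le fun s' => ?_)
  rw [bitrate]
  split_ifs with h
  · obtain rfl : s' = s := Finset.card_le_one.mp (hω u).le _ h _ hu
    exact min_le_right _ _
  · positivity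

/-- With high probability some server has load at least `log n / (4 log log n)`. -/
lemma eventually_minmaxBitrate_le : ∀ᶠ n : ℕ in atTop, ∀ κ : ℕ,
    1 - (n : ℝ) ^ (-(1 / 2) : ℝ) ≤ (initialLaw n 1).real
      {ω | ∀ S : ℕ → State n, IsExecution κ ω S →
        ∀ t : ℕ, minmaxBitrate κ (S t) ≤
          4 * ((κ : ℝ) * Real.log (Real.log (n : ℝ)) / Real.log (n : ℝ))} := by
  have hlog : Tendsto (fun n : ℕ => Real.log (n : ℝ)) atTop atTop :=
    Real.tendsto_log_atTop.comp tendsto_natCast_atTop_atTop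
  have hev1 : ∀ᶠ n : ℕ in atTop, Real.log (Real.log n) ≤ 1 / 2 * Real.log n := by
    have h := (Real.isLittleO_log_id_atTop.comp_tendsto hlog).bound (by norm_num : (0 : ℝ) < 1 / 2)
    filter_upwards [h, hlog.eventually_ge_atTop 1] with n hn hn1
    have h2 : 0 ≤ Real.log (Real.log n) := Real.log_nonneg hn1
    simpa [abs_of_nonneg h2, abs_of_nonneg (zero_le_one.trans hn1)] using hn
  have hev2 : ∀ᶠ n : ℕ in atTop,
      Real.exp 1 ^ 3 * ((√n / Real.exp 1) ^ 2 * Real.exp (-(√n / Real.exp 1))) ≤ 1 := by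
    have h1 : Tendsto (fun n : ℕ => √(n : ℝ) / Real.exp 1) atTop atTop :=
      (Real.tendsto_sqrt_atTop.comp tendsto_natCast_atTop_atTop).atTop_div_const (Real.exp_pos 1)
    have h2 := ((Real.tendsto_pow_mul_exp_neg_atTop_nhds_zero 2).comp h1).const_mul
      (Real.exp 1 ^ 3)
    rw [mul_zero] at h2
    exact h2.eventually_le_const one_pos
  filter_upwards [hev1, hev2, hlog.eventually_ge_atTop 4, eventually_ge_atTop 1]
    with n hLL2 hexp hL4 hn κ
  have := isProbabilityMeasure_initialLaw hn
  set L : ℝ := Real.log n with hL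
  set LL : ℝ := Real.log L with hLL
  have hn0 : (0 : ℝ) < n := by exact_mod_cast hn
  have hLL0 : 0 < LL := Real.log_pos (by linarith)
  have hLL1 : 1 ≤ L / (2 * LL) := by rw [one_le_div (by positivity)]; linarith
  have hLL1' : 1 ≤ LL := by
    rw [hLL, Real.le_log_iff_exp_le (by linarith)]
    linarith [Real.exp_one_lt_d9]
  set k : ℕ := ⌊L / (2 * LL)⌋₊ with hk
  have hk1 : 1 ≤ k := (Nat.one_le_floor_iff _).mpr hLL1
  have hk1' : (1 : ℝ) ≤ k := by exact_mod_cast hk1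
  have hkle : (k : ℝ) ≤ L / (2 * LL) := Nat.floor_le (by positivity)
  have hkge : L / (4 * LL) ≤ k := by
    have h1 : L / (2 * LL) < k + 1 := Nat.lt_floor_add_one _
    have h2 : L / (4 * LL) = L / (2 * LL) / 2 := by field_simp; norm_num
    linarith
  have hkfac : (k.factorial : ℝ) ≤ √n := by
    have h1 : (k.factorial : ℝ) ≤ (k : ℝ) ^ k := by exact_mod_cast Nat.factorial_le_pow k
    have h2 : (k : ℝ) ≤ L := hkle.trans (div_le_self (by linarith) (by linarith))
    calc _ ≤ _ := h1
      _ ≤ L ^ k := by gcongr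
      _ = Real.exp (k * LL) := by rw [Real.exp_nat_mul, Real.exp_log (by linarith)]
      _ ≤ Real.exp (L / 2) := by
        rw [Real.exp_le_exp]
        calc k * LL ≤ L / (2 * LL) * LL := by gcongr
          _ = L / 2 := by field_simp
      _ = √n := by rw [Real.exp_half, Real.exp_log hn0]
  have hprob : (initialLaw n 1).real {ω | ∀ s, load ω s < k} ≤ (n : ℝ) ^ (-(1 / 2) : ℝ) := by
    refine (initialLaw_one_real_load_lt_le_exp hn k).trans ?_
    have hs0 : 0 < √(n : ℝ) := Real.sqrt_pos.mpr hn0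
    have hss : √(n : ℝ) * √n = n := Real.mul_self_sqrt hn0.le
    have h1 : √(n : ℝ) / Real.exp 1 ≤ n / (Real.exp 1 * k.factorial) := by
      rw [div_le_div_iff₀ (Real.exp_pos 1) (by positivity)]
      calc √(n : ℝ) * (Real.exp 1 * k.factorial) ≤ √(n : ℝ) * (Real.exp 1 * √n) := by gcongr
        _ = √(n : ℝ) * √n * Real.exp 1 := by ring
        _ = n * Real.exp 1 := by rw [hss]
    rw [Real.rpow_neg hn0.le, ← Real.sqrt_eq_rpow]
    calc _ ≤ Real.exp 1 * √n * Real.exp (-(√n / Real.exp 1)) := by gcongr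
      _ = (Real.exp 1 ^ 3 * ((√n / Real.exp 1) ^ 2 * Real.exp (-(√n / Real.exp 1)))) *
          (√(n : ℝ))⁻¹ := by field_simp
      _ ≤ 1 * (√(n : ℝ))⁻¹ := by gcongr
      _ = _ := one_mul _
  set G := {ω : State n | ∀ S : ℕ → State n, IsExecution κ ω S →
        ∀ t : ℕ, minmaxBitrate κ (S t) ≤ 4 * ((κ : ℝ) * LL / L)} with hG
  have hcover : Set.univ ⊆ (G ∪ {ω | ∀ u, (ω u).card = 1}ᶜ) ∪ {ω | ∀ s, load ω s < k} := by
    intro ω _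
    by_contra hω
    simp only [Set.mem_union, not_or] at hω
    obtain ⟨⟨hωG, hc⟩, hl⟩ := hω
    have hc : ∀ u, (ω u).card = 1 := not_not.mp hc
    have hl : ¬ ∀ s, load ω s < k := hl
    push Not at hl
    obtain ⟨s, hs⟩ := hl
    refine hωG fun S hS t => ?_
    rw [hS.eq_initial_of_card_eq_one hc t]
    refine (minmaxBitrate_le_div_load hc (hk1.trans hs)).trans ?_
    have h1 : L / (4 * LL) ≤ load ω s := hkge.trans (by exact_mod_cast hs)
    have hLpos : 0 < L / (4 * LL) := by positivity
    calc (κ : ℝ) / load ω s ≤ κ / (L / (4 * LL)) := by gcongr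
      _ = _ := by field_simp
  have h1 : (1 : ℝ) ≤ (initialLaw n 1).real G + 0 +
      (initialLaw n 1).real {ω | ∀ s, load ω s < k} := by
    rw [← initialLaw_real_card_ne n 1, ← probReal_univ (μ := initialLaw n 1)]
    refine (measureReal_mono hcover).trans ((measureReal_union_le _ _).trans ?_)
    exact add_le_add_left (measureReal_union_le _ _) _
  linarith

end Bitrate

theorem mainTheorem3 :
    -- two or more choices
    (∀ σ : ℕ, 2 ≤ σ → ∃ C > (0 : ℝ), ∃ c > (0 : ℝ), ∃ n₀ : ℕ, ∀ n ≥ n₀, ∀ κ : ℕ,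
      Real.exp 1 * ((σ : ℝ) * ((σ : ℝ) - 1)) < (κ : ℝ) + 1 →
        1 - (n : ℝ) ^ (-c) ≤ (Bitrate.initialLaw n σ).real
          {ω | ∀ S : ℕ → Bitrate.State n, Bitrate.IsExecution κ ω S →
            ∀ t : ℕ, C * (Real.log (Real.log (n : ℝ)) / Real.log ((κ : ℝ) + 1)) ≤ (t : ℝ) →
              Bitrate.minmaxBitrate κ (S t) = 1}) ∧
    -- one choice
    (∃ C > (0 : ℝ), ∃ c > (0 : ℝ), ∃ n₀ : ℕ, ∀ n ≥ n₀, ∀ κ : ℕ,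
        1 - (n : ℝ) ^ (-c) ≤ (Bitrate.initialLaw n 1).real
          {ω | ∀ S : ℕ → Bitrate.State n, Bitrate.IsExecution κ ω S →
            ∀ t : ℕ, Bitrate.minmaxBitrate κ (S t) ≤
              C * ((κ : ℝ) * Real.log (Real.log (n : ℝ)) / Real.log (n : ℝ))}) ∧
    -- one choice and small capacities
    (∃ c > (0 : ℝ), ∀ κ : ℕ → ℕ,
      (fun n : ℕ => (κ n : ℝ)) =o[atTop]
          (fun n : ℕ => Real.log (n : ℝ) / Real.log (Real.log (n : ℝ))) →
        ∀ ε > (0 : ℝ), ∀ᶠ n : ℕ in atTop,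
          1 - (n : ℝ) ^ (-c) ≤ (Bitrate.initialLaw n 1).real
            {ω | ∀ S : ℕ → Bitrate.State n, Bitrate.IsExecution (κ n) ω S →
              ∀ t : ℕ, Bitrate.minmaxBitrate (κ n) (S t) ≤ ε}) := by
  refine ⟨Bitrate.minmaxBitrate_eq_one_whp, ?_, 1 / 2, by norm_num, fun κ hκ ε hε => ?_⟩
  · obtain ⟨n₀, hn₀⟩ := eventually_atTop.mp Bitrate.eventually_minmaxBitrate_le
    exact ⟨4, by norm_num, 1 / 2, by norm_num, n₀, hn₀⟩
  · have hlog : Tendsto (fun n : ℕ => Real.log (n : ℝ)) atTop atTop :=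
      Real.tendsto_log_atTop.comp tendsto_natCast_atTop_atTop
    filter_upwards [Bitrate.eventually_minmaxBitrate_le, hκ.bound (by positivity : 0 < ε / 4),
      hlog.eventually_gt_atTop 1, eventually_ge_atTop 1] with n hn hκn hL hn1
    have := Bitrate.isProbabilityMeasure_initialLaw hn1
    have hLL : 0 < Real.log (Real.log n) := Real.log_pos hL
    have hL0 : 0 < Real.log (n : ℝ) := by linarith
    rw [Real.norm_natCast, Real.norm_of_nonneg (by positivity)] at hκn
    refine (hn (κ n)).trans (measureReal_mono fun ω hω S hS t => (hω S hS t).trans ?_)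
    calc 4 * ((κ n : ℝ) * Real.log (Real.log n) / Real.log n)
        ≤ 4 * (ε / 4 * (Real.log n / Real.log (Real.log n)) * Real.log (Real.log n) /
            Real.log n) := by gcongr
      _ = ε := by field_simp
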